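/- For an integer $n\ge 0$ let $S_n$ be the symmetric group on $n$ letters, $A_n\subset S_n$ the alternating group, and let $\tilde S_n$ be the group with generators $z,t_1,\dots,t_{n-1}$ and relations $$z^2=1,\qquad t_i^2=z\ (1\le i\le n-1),\qquad t_{i+1}t_it_{i+1}=t_it_{i+1}t_i\ (1\le i\le n-2),\qquad t_jt_i=z\,t_it_j\ (|i-j|>1),$$ with the homomorphism $\tilde S_n\to S_n$ sending $z\mapsto 1$ and $t_i\mapsto (i,i+1)$. Let $\tilde A_n$ be the preimage of $A_n$ in $\tilde S_n$, with the restricted homomorphism $\tilde A_n\to A_n$. A double cover of a group $G$ is a surjective homomorphism $E\to G$ whose kernel has order $2$; an isomorphism of covers of $G$ is a group isomorphism compatible with the projections to $G$; a double cover is non-trivial if it is not isomorphic, as a cover of $G$, to $G\times\mathbb Z/2\mathbb Z\to G$. Then $\tilde S_n\to S_n$ and $\tilde A_n\to A_n$ are double covers, and: 1. $\tilde A_n\to A_n$ is a non-trivial double cover of $A_n$ if and only if $n\ge 4$. 2. For $n\ge 4$, every non-trivial double cover of $A_n$ is isomorphic, as a cover of $A_n$, to $\tilde A_n\to A_n$.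 Moreover $\tilde A_n\to A_n$ is isomorphic, as a cover of $A_n$, to the pullback of the spin cover $\mathrm{Spin}_n(\mathbb R)\to \mathrm{SO}_n(\mathbb R)$ along the embedding $A_n\hookrightarrow \mathrm{SO}_n(\mathbb R)$ by permutation matrices. -/

import Mathlib

universe u

namespace AltCover

open Matrix CliffordAlgebra

section Covers

variable {E E' G : Type*} [Group E] [Group E'] [Group G]

/-- A double cover (two-fold cover) of a group `G`: a surjective homomorphism `p : E → G` whose
kernel has order two (such a kernel is automatically central). -/
def IsDoubleCover (p : E →* G) : Prop :=
  Function.Surjective p ∧ Nat.card p.ker = 2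

/-- Isomorphism of covers of `G`: a group isomorphism compatible with the projections to `G`. -/
def CoverIso (p : E →* G) (p' : E' →* G) : Prop :=
  ∃ e : E ≃* E', ∀ x, p' (e x) = p x

/-- A double cover is non-trivial if it is not isomorphic, as a cover of `G`, to the direct product
`G × ℤ/2` with its first projection. -/
def IsNontrivialDoubleCover (p : E →* G) : Prop :=
  IsDoubleCover p ∧ ¬ CoverIso p (MonoidHom.fst G (Multiplicative (ZMod 2)))

/-- The fibre product of two group homomorphisms `f : G → K` and `g : H → K`. -/
def fibreProduct {H K : Type*} [Group H] [Group K] (f : G →* K) (g : H →* K) : Subgroup (G × H) :=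
  (f.comp (MonoidHom.fst G H)).eqLocus (g.comp (MonoidHom.snd G H))

/-- The pullback of `g : H → K` along `f : G → K`, as a homomorphism to `G`. -/
def pullbackCover {H K : Type*} [Group H] [Group K] (f : G →* K) (g : H →* K) :
    fibreProduct f g →* G :=
  (MonoidHom.fst G H).comp (fibreProduct f g).subtype

end Covers

section Presentation

/-- The generators `z, t₁, …, t_{n-1}`; here `t i` stands for `t_{i+1}`. -/
inductive Gen (n : ℕ) : Type
  | z : Gen n
  | t (i : Fin (n - 1)) : Gen n

open Gen FreeGroup in
/-- The relations `z² = 1`, `tᵢ² = z`, `tᵢ₊₁ tᵢ tᵢ₊₁ = tᵢ tᵢ₊₁ tᵢ`, and `tⱼ tᵢ = z tᵢ tⱼ` for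
`|i - j| > 1`, each relation `a = b` being written as the relator `a * b⁻¹`. -/
inductive Rel (n : ℕ) : FreeGroup (Gen n) → Prop
  | z_sq : Rel n (of z * of z)
  | t_sq (i : Fin (n - 1)) : Rel n (of (t i) * of (t i) * (of z)⁻¹)
  | braid (i j : Fin (n - 1)) (h : (j : ℕ) = i + 1) :
      Rel n (of (t j) * of (t i) * of (t j) * (of (t i) * of (t j) * of (t i))⁻¹)
  | comm (i j : Fin (n - 1)) (h : (i : ℕ) + 1 < j ∨ (j : ℕ) + 1 < i) :
      Rel n (of (t j) * of (t i) * (of z * of (t i) * of (t j))⁻¹)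

/-- The group `S̃ₙ`. -/
abbrev STilde (n : ℕ) : Type := PresentedGroup {r | Rel n r}

/-- The adjacent transposition `(i, i+1)` (positions counted from `0`). -/
def adjSwap (n : ℕ) (i : Fin (n - 1)) : Equiv.Perm (Fin n) :=
  Equiv.swap ⟨i, by omega⟩ ⟨i + 1, by omega⟩

/-- The images of the generators in `Sₙ`: `z ↦ 1`, `tᵢ ↦ (i, i+1)`. -/
def genToPerm (n : ℕ) : Gen n → Equiv.Perm (Fin n)
  | Gen.z => 1
  | Gen.t i => adjSwap n i

theorem swap_braid {α : Type*} [DecidableEq α] {a b c : α} (hab : a ≠ b) (hac : a ≠ c)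
    (hbc : b ≠ c) : Equiv.swap b c * Equiv.swap a b * Equiv.swap b c =
      Equiv.swap a b * Equiv.swap b c * Equiv.swap a b := by
  rw [Equiv.swap_mul_swap_mul_swap hab hac, Equiv.swap_comm a b, Equiv.swap_comm b c,
    Equiv.swap_mul_swap_mul_swap hbc.symm hac.symm, Equiv.swap_comm]

theorem genToPerm_rel (n : ℕ) :
    ∀ r ∈ {r | Rel n r}, FreeGroup.lift (genToPerm n) r = 1 := by
  rintro r (_ | i | ⟨i, j, h⟩ | ⟨i, j, h⟩)
  · simp [genToPerm]
  · simp [genToPerm, adjSwap]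
  · obtain ⟨i, hi⟩ := i
    obtain ⟨j, hj⟩ := j
    simp only at h
    subst h
    simp only [map_mul, map_inv, FreeGroup.lift_apply_of, genToPerm, adjSwap, mul_inv_eq_one]
    exact swap_braid (by simp) (by simp [Fin.ext_iff]; omega) (by simp)
  · obtain ⟨i, hi⟩ := i
    obtain ⟨j, hj⟩ := j
    simp only at h
    simp only [map_mul, map_inv, FreeGroup.lift_apply_of, genToPerm, adjSwap, mul_inv_eq_one,
      one_mul]
    refine (Equiv.Perm.disjoint_iff_disjoint_support.2 ?_).commute.eq
    rw [Equiv.Perm.support_swap (by simp), Equiv.Perm.support_swap (by simp)]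
    simp
    omega

/-- The projection `S̃ₙ → Sₙ`. -/
def projS (n : ℕ) : STilde n →* Equiv.Perm (Fin n) :=
  PresentedGroup.toGroup (genToPerm_rel n)

/-- The group `Ãₙ`: the preimage of `Aₙ` in `S̃ₙ`. -/
abbrev ATilde (n : ℕ) : Subgroup (STilde n) :=
  (alternatingGroup (Fin n)).comap (projS n)

/-- The projection `Ãₙ → Aₙ`, the restriction of `S̃ₙ → Sₙ`. -/
def projA (n : ℕ) : ATilde n →* alternatingGroup (Fin n) :=
  (projS n).subgroupComap (alternatingGroup (Fin n))

end Presentation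

section Spin

/-- The quadratic form `x₁² + ⋯ + xₙ²` on `ℝⁿ`. -/
def stdForm (n : ℕ) : QuadraticForm ℝ (Fin n → ℝ) :=
  QuadraticMap.weightedSumSquares ℝ (fun _ : Fin n => (1 : ℝ))

/-- The group `Spinₙ(ℝ)`. -/
abbrev Spin (n : ℕ) : Type := spinGroup (stdForm n)

/-- The group `SOₙ(ℝ)`. -/
abbrev SO (n : ℕ) : Type := Matrix.specialOrthogonalGroup (Fin n) ℝ

theorem stdForm_apply {n : ℕ} (v : Fin n → ℝ) : stdForm n v = v ⬝ᵥ v := by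
  simp [stdForm, QuadraticMap.weightedSumSquares_apply, dotProduct]

theorem polar_stdForm {n : ℕ} (v w : Fin n → ℝ) :
    QuadraticMap.polar (stdForm n) v w = 2 * (v ⬝ᵥ w) := by
  simp only [QuadraticMap.polar, stdForm_apply, add_dotProduct, dotProduct_add,
    dotProduct_comm w v]
  ring

theorem ι_stdForm_injective (n : ℕ) : Function.Injective (ι (stdForm n)) := by
  intro v w h
  have h' := congrArg (equivExterior (stdForm n)) h
  simp only [equivExterior, changeFormEquiv_apply, changeForm_ι] at h'
  exact (ExteriorAlgebra.ι_inj ℝ v w).1 h'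

/-- The matrix of the reflection in the vector `a`. -/
noncomputable def reflMatrix {n : ℕ} (a : Fin n → ℝ) : Matrix (Fin n) (Fin n) ℝ :=
  1 + replicateCol Unit ((-(2 / stdForm n a)) • a) * replicateRow Unit a

theorem reflMatrix_mulVec {n : ℕ} (a v : Fin n → ℝ) :
    reflMatrix a *ᵥ v = v - (2 / stdForm n a * (a ⬝ᵥ v)) • a := by
  rw [reflMatrix, add_mulVec, one_mulVec, ← mulVec_mulVec]
  ext i
  simp [-mulVec_mulVec, mulVec, dotProduct]
  ring

theorem det_reflMatrix {n : ℕ} (a : Fin n → ℝ) (ha : stdForm n a ≠ 0) :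
    (reflMatrix a).det = -1 := by
  rw [reflMatrix, det_one_add_replicateCol_mul_replicateRow, dotProduct_smul, ← stdForm_apply,
    smul_eq_mul]
  field_simp
  ring

theorem ι_mul_refl {n : ℕ} (a v : Fin n → ℝ) (ha : stdForm n a ≠ 0) :
    -ι (stdForm n) a * ι (stdForm n) v = ι (stdForm n) (reflMatrix a *ᵥ v) * ι (stdForm n) a := by
  have h1 := ι_mul_ι_add_swap (Q := stdForm n) a v
  rw [polar_stdForm] at h1
  have h2 : 2 / stdForm n a * (a ⬝ᵥ v) * stdForm n a = 2 * (a ⬝ᵥ v) := by field_simp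
  rw [reflMatrix_mulVec, map_sub, map_smul, sub_mul, smul_mul_assoc, ι_sq_scalar,
    Algebra.smul_def, ← map_mul (algebraMap ℝ _), h2, ← h1]
  noncomm_ring

/-- Twisted conjugation by an element of the Lipschitz group is given by a matrix, of determinant
`1` or `-1` according to the parity of the element. -/
theorem exists_twisted {n : ℕ} {x : (CliffordAlgebra (stdForm n))ˣ}
    (hx : x ∈ lipschitzGroup (stdForm n)) :
    ∃ M : Matrix (Fin n) (Fin n) ℝ,
      (∀ v, involute (x : CliffordAlgebra (stdForm n)) * ι (stdForm n) v =
        ι (stdForm n) (M *ᵥ v) * x) ∧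
      ((involute (x : CliffordAlgebra (stdForm n)) = x ∧ M.det = 1) ∨
        (involute (x : CliffordAlgebra (stdForm n)) = -x ∧ M.det = -1)) := by
  unfold lipschitzGroup at hx
  induction hx using Subgroup.closure_induction with
  | mem x hx =>
    obtain ⟨a, ha⟩ := hx
    have ha0 : stdForm n a ≠ 0 := by
      intro h0
      have h := ι_sq_scalar (stdForm n) a
      rw [h0, map_zero, ha] at h
      exact (x * x).ne_zero h
    refine ⟨reflMatrix a, fun v => ?_, Or.inr ⟨?_, det_reflMatrix a ha0⟩⟩
    · rw [← ha, involute_ι, ι_mul_refl a v ha0]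
    · rw [← ha, involute_ι]
  | one => exact ⟨1, by simp, Or.inl (by simp)⟩
  | mul x y _ _ hx hy =>
    obtain ⟨M, hM, hM'⟩ := hx
    obtain ⟨N, hN, hN'⟩ := hy
    refine ⟨M * N, fun v => ?_, ?_⟩
    · rw [Units.val_mul, map_mul, mul_assoc, hN, ← mul_assoc, hM, mul_assoc, mulVec_mulVec]
    · rw [Units.val_mul, map_mul, det_mul]
      rcases hM' with ⟨h1, h2⟩ | ⟨h1, h2⟩ <;> rcases hN' with ⟨h3, h4⟩ | ⟨h3, h4⟩ <;>
        simp [h1, h2, h3, h4]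
  | inv x _ hx =>
    obtain ⟨M, hM, hM'⟩ := hx
    have hdet : IsUnit M.det := by
      rcases hM' with ⟨_, h⟩ | ⟨_, h⟩ <;> simp [h]
    have hinv : involute (x : CliffordAlgebra (stdForm n)) *
        involute ((x⁻¹ : (CliffordAlgebra (stdForm n))ˣ) : CliffordAlgebra (stdForm n)) = 1 := by
      rw [← map_mul, Units.mul_inv, map_one]
    have hinv' : involute ((x⁻¹ : (CliffordAlgebra (stdForm n))ˣ) : CliffordAlgebra (stdForm n)) *
        involute (x : CliffordAlgebra (stdForm n)) = 1 := by
      rw [← map_mul, Units.inv_mul, map_one]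
    refine ⟨M⁻¹, fun v => ?_, ?_⟩
    · have h := hM (M⁻¹ *ᵥ v)
      rw [mulVec_mulVec, mul_nonsing_inv M hdet, one_mulVec] at h
      rw [Units.eq_mul_inv_iff_mul_eq, mul_assoc, ← h, ← mul_assoc, hinv', one_mul]
    · rw [det_nonsing_inv]
      rcases hM' with ⟨h1, h2⟩ | ⟨h1, h2⟩
      · refine Or.inl ⟨?_, by simp [h2]⟩
        rw [h1] at hinv
        exact (Units.inv_eq_of_mul_eq_one_right hinv).symm
      · refine Or.inr ⟨?_, ?_⟩
        · rw [h1, neg_mul, ← mul_neg] at hinv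
          have h3 := Units.inv_eq_of_mul_eq_one_right hinv
          rw [h3, neg_neg, ← h3]
        · rw [h2, Ring.inverse_eq_inv']
          norm_num

theorem mem_orthogonal_of_form {n : ℕ} (M : Matrix (Fin n) (Fin n) ℝ)
    (h : ∀ v, stdForm n (M *ᵥ v) = stdForm n v) : M ∈ Matrix.orthogonalGroup (Fin n) ℝ := by
  have hp : ∀ v w, (M *ᵥ v) ⬝ᵥ (M *ᵥ w) = v ⬝ᵥ w := by
    intro v w
    have h1 := polar_stdForm (M *ᵥ v) (M *ᵥ w)
    rw [QuadraticMap.polar, ← mulVec_add, h, h, h, ← QuadraticMap.polar, polar_stdForm] at h1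
    linarith
  rw [Matrix.mem_orthogonalGroup_iff']
  ext i j
  have := hp (Pi.single i 1) (Pi.single j 1)
  rw [mulVec_single_one, mulVec_single_one] at this
  simpa [mul_apply, dotProduct, one_apply, Pi.single_apply, star_eq_conjTranspose, eq_comm]
    using this

/-- Conjugation by an element of `Spinₙ(ℝ)` preserves `ℝⁿ` and acts on it by an element of
`SOₙ(ℝ)`. -/
theorem exists_spin_action {n : ℕ} (x : Spin n) :
    ∃ M : SO n, ∀ v : Fin n → ℝ,
      (x : CliffordAlgebra (stdForm n)) * ι (stdForm n) v * (x⁻¹ : Spin n) =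
        ι (stdForm n) ((M : Matrix (Fin n) (Fin n) ℝ) *ᵥ v) := by
  have hxl : spinGroup.toUnits x ∈ lipschitzGroup (stdForm n) :=
    spinGroup.units_mem_lipschitzGroup x.2
  obtain ⟨M, hM, hM'⟩ := exists_twisted hxl
  have hxi : involute (x : CliffordAlgebra (stdForm n)) = x := spinGroup.involute_eq x.2
  have hinv : (x : CliffordAlgebra (stdForm n)) * ((x⁻¹ : Spin n) : CliffordAlgebra (stdForm n))
      = 1 := spinGroup.coe_mul_star_self x
  have hinv' : ((x⁻¹ : Spin n) : CliffordAlgebra (stdForm n)) * (x : CliffordAlgebra (stdForm n))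
      = 1 := spinGroup.coe_star_mul_self x
  have hact : ∀ v, (x : CliffordAlgebra (stdForm n)) * ι (stdForm n) v * (x⁻¹ : Spin n) =
      ι (stdForm n) (M *ᵥ v) := by
    intro v
    have h := hM v
    rw [spinGroup.val_toUnits_apply, hxi] at h
    rw [h, mul_assoc, hinv, mul_one]
  have hdet : M.det = 1 := by
    rcases hM' with ⟨_, h⟩ | ⟨h, _⟩
    · exact h
    · exfalso
      rw [spinGroup.val_toUnits_apply, hxi] at h
      have h2 : (2 : ℝ) • (x : CliffordAlgebra (stdForm n)) = 0 := by
        rw [two_smul]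
        nth_rewrite 2 [h]
        exact add_neg_cancel _
      have h3 := (smul_eq_zero.1 h2).resolve_left two_ne_zero
      rw [h3, zero_mul] at hinv
      exact zero_ne_one hinv
  refine ⟨⟨M, Matrix.mem_specialOrthogonalGroup_iff.2 ⟨mem_orthogonal_of_form M fun v => ?_, hdet⟩⟩,
    hact⟩
  apply (algebraMap ℝ (CliffordAlgebra (stdForm n))).injective
  rw [← ι_sq_scalar, ← hact]
  calc (x : CliffordAlgebra (stdForm n)) * ι (stdForm n) v * (x⁻¹ : Spin n) *
        (x * ι (stdForm n) v * (x⁻¹ : Spin n))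
      = x * ι (stdForm n) v * ((x⁻¹ : Spin n) * x) * ι (stdForm n) v * (x⁻¹ : Spin n) := by
        noncomm_ring
    _ = x * (ι (stdForm n) v * ι (stdForm n) v) * (x⁻¹ : Spin n) := by
        rw [hinv']; noncomm_ring
    _ = algebraMap ℝ _ (stdForm n v) := by
        rw [ι_sq_scalar, ← Algebra.commutes, mul_assoc, hinv, mul_one]

theorem SO_ext {n : ℕ} {M N : SO n}
    (h : ∀ v : Fin n → ℝ, ι (stdForm n) ((M : Matrix (Fin n) (Fin n) ℝ) *ᵥ v) =
      ι (stdForm n) ((N : Matrix (Fin n) (Fin n) ℝ) *ᵥ v)) : M = N :=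
  Subtype.ext (Matrix.mulVec_injective (funext fun v => ι_stdForm_injective n (h v)))

/-- The spin cover `Spinₙ(ℝ) → SOₙ(ℝ)`: `x` is sent to the matrix of `v ↦ x v x⁻¹`. -/
noncomputable def spinToSO (n : ℕ) : Spin n →* SO n where
  toFun x := (exists_spin_action x).choose
  map_one' := SO_ext fun v => by
    rw [← (exists_spin_action (1 : Spin n)).choose_spec v]
    simp
  map_mul' x y := SO_ext fun v => by
    rw [← (exists_spin_action (x * y)).choose_spec v, Submonoid.coe_mul, Submonoid.coe_mul, ← mulVec_mulVec,
      ← (exists_spin_action x).choose_spec, ← (exists_spin_action y).choose_spec]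
    simp [mul_assoc]

theorem spinToSO_spec {n : ℕ} (x : Spin n) (v : Fin n → ℝ) :
    ι (stdForm n) ((spinToSO n x : Matrix (Fin n) (Fin n) ℝ) *ᵥ v) =
      (x : CliffordAlgebra (stdForm n)) * ι (stdForm n) v * (x⁻¹ : Spin n) :=
  ((exists_spin_action x).choose_spec v).symm

/-- The embedding `Aₙ → SOₙ(ℝ)` by permutation matrices: `σ` is sent to the matrix `P` with
`P eᵢ = e_{σ i}`. -/
def altToSO (n : ℕ) : alternatingGroup (Fin n) →* SO n where
  toFun σ := ⟨((σ : Equiv.Perm (Fin n))⁻¹).permMatrix ℝ, by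
    rw [Matrix.mem_specialOrthogonalGroup_iff, Matrix.mem_orthogonalGroup_iff, det_permutation,
      Equiv.Perm.sign_inv, Equiv.Perm.mem_alternatingGroup.1 σ.2,
      transpose_permMatrix, ← permMatrix_mul]
    simp⟩
  map_one' := Subtype.ext (by simp)
  map_mul' σ τ := Subtype.ext (by simp [permMatrix_mul])

theorem altToSO_single {n : ℕ} (σ : alternatingGroup (Fin n)) (i : Fin n) :
    (altToSO n σ : Matrix (Fin n) (Fin n) ℝ) *ᵥ Pi.single i 1 =
      Pi.single ((σ : Equiv.Perm (Fin n)) i) 1 := by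
  ext j
  simp only [altToSO, MonoidHom.coe_mk, OneHom.coe_mk, permMatrix_mulVec, Function.comp_apply,
    Pi.single_apply, Equiv.Perm.inv_eq_iff_eq]

/-- The double cover of `Aₙ` obtained by pulling back `Spinₙ(ℝ) → SOₙ(ℝ)` along `Aₙ → SOₙ(ℝ)`. -/
noncomputable def spinCoverA (n : ℕ) :
    fibreProduct (altToSO n) (spinToSO n) →* alternatingGroup (Fin n) :=
  pullbackCover (altToSO n) (spinToSO n)

end Spin

end AltCover

namespace AltCover

/-! ### Upper bounds for orders of groups with Coxeter or Carmichael relations. -/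

section Counting

open scoped Nat

variable {G : Type*} [Group G]

/-! A double cover of `Aₙ` is determined by one bit: whether the lifts of a product of two disjoint
transpositions are involutions. All such products are conjugate in `Aₙ`, and the kernel is central
of order two, so all these lifts have the same square (`sq_eq_sq_of_lift`).

To see that the bit suffices, take two covers with the same bit and form their Baer sum, in which
every lift of `(a i)(b j)` is an involution. Carmichael's generators `xᵢ = (a b i)` of `Aₙ` have
lifts of order dividing three, and `xᵢ xⱼ = (a i)(b j)`, so these lifts satisfy `xᵢ³ = (xᵢ xⱼ)² =
1`. A coset count shows that a group with such generators has at most `n!/2` elements, so the lifts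
generate a copy of `Aₙ` and the Baer sum splits (`exists_section_of_sq_eq_one`). A splitting of the
Baer sum is the graph of an isomorphism of covers (`coverIso_of_section`).

It remains to compute the bit. In the trivial cover the squares are `1`. In `Ãₙ` the lift `t₁ t₃`
has square `z`, and in the pullback of `Spinₙ` a product of two orthogonal unit vectors has square
`-1`. For `n < 4` there are no four distinct letters, so every double cover is trivial. That `S̃ₙ →
Sₙ` has kernel of order exactly two combines the bound `n!` for the Coxeter relations with a
representation in a Clifford algebra sending `z` to `-1`. That `Spinₙ → SOₙ` has kernel `{1, -1}`
follows because an even element commuting with all vectors is a scalar. -/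

theorem exists_mul_of_mem_closure {H : Subgroup G} {R X : Set G} (hR : 1 ∈ R)
    (hX : ∀ x ∈ X, ∃ k : ℕ, x⁻¹ = x ^ k)
    (hmul : ∀ r ∈ R, ∀ x ∈ X, ∃ h ∈ H, ∃ r' ∈ R, r * x = h * r') {g : G}
    (hg : g ∈ Subgroup.closure X) : ∃ h ∈ H, ∃ r ∈ R, g = h * r := by
  have step : ∀ x ∈ X, ∀ g, (∃ h ∈ H, ∃ r ∈ R, g = h * r) → ∃ h ∈ H, ∃ r ∈ R, g * x = h * r := by
    rintro x hx g ⟨h, hh, r, hr, rfl⟩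
    obtain ⟨h', hh', r', hr', e⟩ := hmul r hr x hx
    exact ⟨h * h', H.mul_mem hh hh', r', hr', by rw [mul_assoc, e, mul_assoc]⟩
  induction hg using Subgroup.closure_induction_right with
  | one => exact ⟨1, H.one_mem, 1, hR, by simp⟩
  | mul_right g hg x hx ih => exact step x hx _ ih
  | mul_inv_cancel g hg x hx ih =>
    obtain ⟨k, hk⟩ := hX x hx
    rw [hk]
    clear hk
    induction k with
    | zero => simpa using ih
    | succ k ihk =>
      rw [pow_succ, ← mul_assoc]
      exact step x hx _ ihk

/-- Coset enumeration: `H R` contains `1` and is stable under right multiplication by generators,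
hence contains the generated group. As inverses of generators are powers of them, only positive
words need checking. -/
theorem card_closure_le {H : Subgroup G} [Finite H] {X : Set G} (R : Finset G) (hR : 1 ∈ R)
    (hX : ∀ x ∈ X, ∃ k : ℕ, x⁻¹ = x ^ k)
    (hmul : ∀ r ∈ R, ∀ x ∈ X, ∃ h ∈ H, ∃ r' ∈ R, r * x = h * r') :
    Finite (Subgroup.closure X) ∧ Nat.card (Subgroup.closure X) ≤ Nat.card H * R.card := by
  have key : ∀ g : Subgroup.closure X, ∃ q : H × R, (g : G) = q.1 * q.2 := by
    rintro ⟨g, hg⟩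
    obtain ⟨h, hh, r, hr, e⟩ :=
      exists_mul_of_mem_closure (R := (R : Set G)) (by simpa using hR) hX
        (by simpa using hmul) hg
    exact ⟨(⟨h, hh⟩, ⟨r, hr⟩), e⟩
  choose f hf using key
  have hinj : Function.Injective f := fun a b e => Subtype.ext (by rw [hf a, hf b, e])
  refine ⟨Finite.of_injective f hinj, ?_⟩
  have := Nat.card_le_card_of_injective f hinj
  rwa [Nat.card_prod, Nat.card_eq_fintype_card (α := R), Fintype.card_coe] at this

/-- A group generated by elements `xᵢ` with `xᵢ³ = 1` and `(xᵢ xⱼ)² = 1` for `i ≠ j`, where `i`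
runs over `m` indices, has at most `(m + 2)! / 2` elements. -/
theorem card_closure_of_threeCycle_relations {ι : Type*} [DecidableEq ι] (x : ι → G)
    (h3 : ∀ i, x i * x i * x i = 1) (h2 : ∀ i j, i ≠ j → x i * x j * (x i * x j) = 1)
    (s : Finset ι) :
    Finite (Subgroup.closure (x '' s)) ∧
      2 * Nat.card (Subgroup.closure (x '' s)) ≤ (s.card + 2)! := by
  classical
  induction s using Finset.induction_on with
  | empty =>
    rw [Finset.coe_empty, Set.image_empty, Subgroup.closure_empty]
    exact ⟨inferInstance, by simp⟩
  | insert a s ha ih =>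
    obtain ⟨hfin, hcard⟩ := ih
    set H := Subgroup.closure (x '' s)
    have hxH : ∀ i ∈ s, x i ∈ H := fun i hi => Subgroup.subset_closure ⟨i, hi, rfl⟩
    have hinv : ∀ i, (x i)⁻¹ = x i * x i := fun i =>
      inv_eq_of_mul_eq_one_left (h3 i)
    have hswap : ∀ i j, i ≠ j → x i * x j = (x j)⁻¹ * (x i)⁻¹ := fun i j hij => by
      rw [← mul_inv_rev, eq_inv_iff_mul_eq_one, h2 i j hij]
    set y := x a
    have hne : ∀ i ∈ s, i ≠ a := fun i hi e => ha (e ▸ hi)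
    -- With `m = s.card`, these at most `m + 3` representatives match the index of `A_{m+2}` in
    -- `A_{m+3}`.
    let R : Finset G := {1, y, y⁻¹} ∪ s.image (fun j => y⁻¹ * x j)
    have hRc : R.card ≤ s.card + 3 := by
      refine (Finset.card_union_le _ _).trans ?_
      have h1 : ({1, y, y⁻¹} : Finset G).card ≤ 3 := Finset.card_le_three
      have h2 : (s.image (fun j => y⁻¹ * x j)).card ≤ s.card := Finset.card_image_le
      omega
    have m1 : (1 : G) ∈ R := by simp [R]
    have my : y ∈ R := by simp [R]
    have myi : y⁻¹ ∈ R := by simp [R]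
    have mj : ∀ j ∈ s, y⁻¹ * x j ∈ R := fun j hj =>
      Finset.mem_union_right _ (Finset.mem_image_of_mem _ hj)
    have hxinv : ∀ z ∈ x '' ↑(insert a s), ∃ k : ℕ, z⁻¹ = z ^ k := by
      rintro _ ⟨i, -, rfl⟩
      exact ⟨2, by rw [hinv, pow_two]⟩
    have hmul : ∀ r ∈ R, ∀ z ∈ x '' ↑(insert a s), ∃ h ∈ H, ∃ r' ∈ R, r * z = h * r' := by
      rintro r hr _ ⟨k, hk, rfl⟩
      have hk' : k = a ∨ k ∈ s := by simpa using hk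
      simp only [R, Finset.mem_union, Finset.mem_insert, Finset.mem_singleton,
        Finset.mem_image] at hr
      rcases hr with (rfl | rfl | rfl) | ⟨j, hj, rfl⟩ <;> rcases hk' with rfl | hk
      · exact ⟨1, H.one_mem, y, my, rfl⟩
      · exact ⟨x k, hxH k hk, 1, m1, by simp⟩
      · exact ⟨1, H.one_mem, y⁻¹, myi, by rw [one_mul, hinv]⟩
      · exact ⟨(x k)⁻¹, H.inv_mem (hxH k hk), y⁻¹, myi, hswap _ _ (hne k hk).symm⟩
      · exact ⟨1, H.one_mem, 1, m1, by simp [y]⟩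
      · exact ⟨1, H.one_mem, _, mj k hk, by simp⟩
      · refine ⟨(x j)⁻¹, H.inv_mem (hxH j hj), _, mj j hj, ?_⟩
        calc y⁻¹ * x j * y = y⁻¹ * (x j * y) := mul_assoc _ _ _
          _ = y⁻¹ * y⁻¹ * (x j)⁻¹ := by rw [hswap _ _ (hne j hj), mul_assoc]
          _ = y * (x j)⁻¹ := by
            rw [← mul_inv_rev, ← hinv, inv_inv]
          _ = (y * x j) * x j := by rw [hinv, mul_assoc]
          _ = (x j)⁻¹ * (y⁻¹ * x j) := by rw [hswap _ _ (hne j hj).symm, mul_assoc]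
      · by_cases hjk : k = j
        · subst hjk
          exact ⟨x k, hxH k hk, y, my, by rw [mul_assoc, ← hinv, ← hswap _ _ (hne k hk)]⟩
        · refine ⟨x k * (x j)⁻¹, H.mul_mem (hxH k hk) (H.inv_mem (hxH j hj)), _, mj j hj, ?_⟩
          calc y⁻¹ * x j * x k = y⁻¹ * (x k)⁻¹ * (x j)⁻¹ := by
                rw [mul_assoc, hswap _ _ (Ne.symm hjk), mul_assoc]
            _ = x k * y * (x j)⁻¹ := by rw [← hswap _ _ (hne k hk)]
            _ = x k * (y * x j) * x j := by rw [hinv]; simp only [mul_assoc]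
            _ = _ := by rw [hswap _ _ (hne j hj).symm]; simp only [mul_assoc, y]
    obtain ⟨hf, hc⟩ := card_closure_le (H := H) R m1 hxinv hmul
    refine ⟨hf, ?_⟩
    rw [Finset.card_insert_of_notMem ha, show s.card + 1 + 2 = (s.card + 2) + 1 by ring,
      Nat.factorial_succ]
    calc _ ≤ 2 * (Nat.card H * R.card) := Nat.mul_le_mul_left _ hc
      _ = R.card * (2 * Nat.card H) := by ring
      _ ≤ (s.card + 3) * (s.card + 2)! := Nat.mul_le_mul hRc hcard

/-- The product `s_m s_{m-1} ⋯` with `k` factors. -/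
def descProd (s : ℕ → G) (m : ℕ) : ℕ → G
  | 0 => 1
  | k + 1 => descProd s m k * s (m - k)

/-- A group generated by elements `s₀, …, s_{m-1}` satisfying the Coxeter relations of type `A_m`
has at most `(m + 1)!` elements. -/
theorem card_closure_of_coxeter_relations (s : ℕ → G) (m : ℕ) (hsq : ∀ i < m, s i * s i = 1)
    (hbr : ∀ i, i + 1 < m → s (i + 1) * s i * s (i + 1) = s i * s (i + 1) * s i)
    (hcomm : ∀ i j, i + 1 < j → j < m → s j * s i = s i * s j) :
    Finite (Subgroup.closure (s '' Set.Iio m)) ∧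
      Nat.card (Subgroup.closure (s '' Set.Iio m)) ≤ (m + 1)! := by
  classical
  induction m with
  | zero =>
    rw [show Set.Iio 0 = (∅ : Set ℕ) by ext; simp, Set.image_empty, Subgroup.closure_empty]
    exact ⟨inferInstance, by simp⟩
  | succ m ih =>
    obtain ⟨hfin, hcard⟩ := ih (fun i hi => hsq i (by omega)) (fun i hi => hbr i (by omega))
      (fun i j hi hj => hcomm i j hi (by omega))
    set H := Subgroup.closure (s '' Set.Iio m)
    have hsH : ∀ i < m, s i ∈ H := fun i hi => Subgroup.subset_closure ⟨i, hi, rfl⟩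
    set w := descProd s m
    have w_succ : ∀ k, w (k + 1) = w k * s (m - k) := fun k => rfl
    have hlow : ∀ k j, j + k < m → w k * s j = s j * w k := by
      intro k j hj
      induction k with
      | zero => simp [w, descProd]
      | succ k ihk =>
        rw [w_succ, mul_assoc, hcomm j (m - k) (by omega) (by omega), ← mul_assoc,
          ihk (by omega), mul_assoc]
    have hhigh : ∀ k j, j ≤ m → m + 2 ≤ j + k → k ≤ m + 1 → w k * s j = s (j - 1) * w k := by
      intro k j hjm hj hk
      induction k with
      | zero => omega
      | succ k ihk =>
        -- Either the last two factors are `s_j s_{j-1}` and the braid relation applies, or `s_j`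
        -- commutes with the last factor.
        rcases Nat.lt_or_ge (j + k) (m + 2) with hlt | hge
        · obtain ⟨k, rfl⟩ : ∃ l, k = l + 1 := ⟨k - 1, by omega⟩
          obtain ⟨i, rfl⟩ : ∃ i, j = i + 1 := ⟨j - 1, by omega⟩
          rw [w_succ, w_succ, show m - k = i + 1 by omega, show m - (k + 1) = i by omega,
            mul_assoc, mul_assoc, ← mul_assoc (s (i + 1)), hbr i (by omega), ← mul_assoc,
            ← mul_assoc, hlow k i (by omega), Nat.add_sub_cancel]
          simp only [mul_assoc]
        · rw [w_succ, mul_assoc, ← hcomm (m - k) j (by omega) (by omega), ← mul_assoc,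
            ihk hge (by omega), mul_assoc]
    let R : Finset G := (Finset.range (m + 2)).image w
    have hwR : ∀ k ≤ m + 1, w k ∈ R := fun k hk =>
      Finset.mem_image_of_mem _ (Finset.mem_range.2 (by omega))
    have hmul : ∀ r ∈ R, ∀ z ∈ s '' Set.Iio (m + 1), ∃ h ∈ H, ∃ r' ∈ R, r * z = h * r' := by
      rintro r hr _ ⟨j, hj, rfl⟩
      obtain ⟨k, hk, rfl⟩ := Finset.mem_image.1 hr
      rw [Finset.mem_range] at hk
      rw [Set.mem_Iio] at hj
      -- `w k = s_m ⋯ s_{m-k+1}`. Multiplying by `s_j` on the right: a small `j` commutes through,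
      -- `j = m - k` lengthens the word, `j = m - k + 1` shortens it, and a larger `j` passes
      -- through as `s_{j-1}`.
      rcases Nat.lt_trichotomy (j + k) m with h | h | h
      · exact ⟨s j, hsH j (by omega), _, hwR k (by omega), hlow k j h⟩
      · exact ⟨1, H.one_mem, _, hwR (k + 1) (by omega), by
          rw [w_succ, one_mul, show m - k = j by omega]⟩
      · rcases Nat.lt_or_ge (j + k) (m + 2) with h' | h'
        · obtain ⟨k, rfl⟩ : ∃ l, k = l + 1 := ⟨k - 1, by omega⟩
          exact ⟨1, H.one_mem, _, hwR k (by omega), by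
            rw [w_succ, show m - k = j by omega, mul_assoc, hsq j hj, mul_one, one_mul]⟩
        · exact ⟨s (j - 1), hsH _ (by omega), _, hwR k (by omega),
            hhigh k j (by omega) h' (by omega)⟩
    obtain ⟨hf, hc⟩ := card_closure_le (H := H) R (hwR 0 (by omega)) (by
      rintro _ ⟨i, hi, rfl⟩
      exact ⟨1, by rw [pow_one]; exact inv_eq_of_mul_eq_one_left (hsq i hi)⟩) hmul
    refine ⟨hf, hc.trans ?_⟩
    rw [Nat.factorial_succ (m + 1), mul_comm]
    exact Nat.mul_le_mul (Finset.card_image_le.trans (by simp)) hcard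

end Counting

/-! ### Three-cycles, double transpositions and splitting of extensions of `Aₙ`. -/

section ThreeCycles

open Equiv Equiv.Perm

/-- Conjugating `(b i)` by `(a b)` gives `(a i)`. This turns the relation `(xᵢ xⱼ)² = 1` for lifts
into a condition on lifts of double transpositions. -/
theorem threeCycle_mul_threeCycle {α : Type*} [DecidableEq α] {a b i j : α} (hia : i ≠ a)
    (hib : i ≠ b) :
    swap a b * swap b i * (swap a b * swap b j) = swap a i * swap b j := by
  rw [← mul_assoc, swap_comm a b, mul_assoc (swap b a), ← mul_assoc (swap b a), swap_comm b i,
    swap_mul_swap_mul_swap hib hia, swap_comm]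

variable {α : Type*} [Fintype α] [DecidableEq α] {a b : α}

theorem swap_mul_swap_mem_alternatingGroup {i j k l : α} (hij : i ≠ j) (hkl : k ≠ l) :
    swap i j * swap k l ∈ alternatingGroup α := by
  rw [mem_alternatingGroup, Perm.sign_mul, sign_swap hij, sign_swap hkl]
  rfl

theorem threeCycle_cube {i : α} (hab : a ≠ b) (ha : i ≠ a) (hb : i ≠ b) :
    swap a b * swap b i * (swap a b * swap b i) * (swap a b * swap b i) = 1 := by
  have h : (swap b a * swap b i).IsThreeCycle := isThreeCycle_swap_mul_swap_same hab.symm hb.symm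
    ha.symm
  rw [swap_comm a b, ← pow_two, ← pow_succ]
  exact orderOf_dvd_iff_pow_eq_one.1 (dvd_of_eq h.orderOf)

/-- The group `N` generated by these three-cycles is normalised by `s = (a b)`, which inverts each
generator. Hence `N ∪ sN` is a group; it contains every `(b i)`, so every transposition, and parity
separates `N` from `sN`. -/
theorem mem_closure_threeCycles (hab : a ≠ b) {σ : Perm α} (hσ : σ ∈ alternatingGroup α) :
    σ ∈ Subgroup.closure {τ | ∃ i, i ≠ a ∧ i ≠ b ∧ τ = swap a b * swap b i} := by
  set N := Subgroup.closure {τ : Perm α | ∃ i, i ≠ a ∧ i ≠ b ∧ τ = swap a b * swap b i} with hN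
  set s := swap a b with hs
  have hss : ∀ τ, s * (s * τ) = τ := fun τ => by rw [← mul_assoc, hs, swap_mul_self, one_mul]
  have hconj : ∀ τ ∈ N, s * τ * s ∈ N := by
    intro τ hτ
    induction hτ using Subgroup.closure_induction with
    | mem τ hτ =>
      obtain ⟨i, hia, hib, rfl⟩ := hτ
      have : s * (s * swap b i) * s = (s * swap b i)⁻¹ := by
        rw [hss, mul_inv_rev, swap_inv, hs, swap_inv]
      rw [this]
      exact N.inv_mem (Subgroup.subset_closure ⟨i, hia, hib, rfl⟩)
    | one => simp [hs]
    | mul x y _ _ hx hy =>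
      have := N.mul_mem hx hy
      rwa [show s * x * s * (s * y * s) = s * (x * y) * s by
        simp only [mul_assoc, hss]] at this
    | inv x _ hx =>
      have := N.inv_mem hx
      rwa [mul_inv_rev, mul_inv_rev, hs, swap_inv, ← mul_assoc] at this
  let T : Subgroup (Perm α) :=
    { carrier := {τ | τ ∈ N ∨ s * τ ∈ N}
      one_mem' := Or.inl N.one_mem
      mul_mem' := by
        rintro x y (hx | hx) (hy | hy)
        · exact Or.inl (N.mul_mem hx hy)
        · refine Or.inr ?_
          have := N.mul_mem (hconj x hx) hy
          rwa [show s * x * s * (s * y) = s * (x * y) by simp only [mul_assoc, hss]] at this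
        · exact Or.inr (by rw [← mul_assoc]; exact N.mul_mem hx hy)
        · refine Or.inl ?_
          have := N.mul_mem (hconj _ hx) hy
          rwa [show s * (s * x) * s * (s * y) = x * y by simp only [mul_assoc, hss]] at this
      inv_mem' := by
        rintro x (hx | hx)
        · exact Or.inl (N.inv_mem hx)
        · refine Or.inr ?_
          have := hconj _ (N.inv_mem hx)
          rwa [mul_inv_rev, show s⁻¹ = s from swap_inv _ _,
            show s * (x⁻¹ * s) * s = s * x⁻¹ * (s * (s * 1)) by simp only [mul_assoc, mul_one],
            hss, mul_one] at this }
  have hb : ∀ i, swap b i ∈ T := by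
    intro i
    by_cases hia : i = a
    · subst hia
      exact Or.inr (by rw [swap_comm, ← hs, ← mul_one (s * s), mul_assoc, hss]; exact N.one_mem)
    · by_cases hib : i = b
      · subst hib
        rw [swap_self]
        exact T.one_mem
      · exact Or.inr (Subgroup.subset_closure ⟨i, hia, hib, rfl⟩)
  have hT : σ ∈ T := by
    have : T = ⊤ := by
      rw [eq_top_iff, ← closure_isSwap, Subgroup.closure_le]
      rintro _ ⟨i, j, hij, rfl⟩
      by_cases hjb : j = b
      · subst hjb
        rw [swap_comm]
        exact hb i
      · rw [← swap_mul_swap_mul_swap (x := j) (y := b) (z := i) hjb hij.symm, swap_comm j b]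
        exact T.mul_mem (T.mul_mem (hb i) (hb j)) (hb i)
    rw [this]
    trivial
  rcases hT with h | h
  · exact h
  · exfalso
    have hNA : N ≤ alternatingGroup α := by
      rw [hN, Subgroup.closure_le]
      rintro _ ⟨i, -, hib, rfl⟩
      exact swap_mul_swap_mem_alternatingGroup hab hib.symm
    have h1 := hNA h
    rw [mem_alternatingGroup, Perm.sign_mul, sign_swap hab, mem_alternatingGroup.1 hσ] at h1
    exact absurd h1 (by decide)

/-- Over `Aₙ`, a central extension by a group of exponent two in which the lifts of the products of
two disjoint transpositions `(a i)(b j)` are involutions splits. -/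
theorem exists_section_of_sq_eq_one {B : Type*} [Group B] (q : B →* alternatingGroup α)
    (hq : Function.Surjective q) (hK : ∀ k, q k = 1 → k * k = 1 ∧ ∀ g, g * k = k * g)
    (hab : a ≠ b)
    (h2 : ∀ i j, i ≠ a → i ≠ b → j ≠ a → j ≠ b → i ≠ j → ∀ e : B,
      (q e : Perm α) = swap a i * swap b j → e * e = 1) :
    ∃ s : alternatingGroup α →* B, ∀ σ, q (s σ) = σ := by
  classical
  have : Nontrivial α := ⟨a, b, hab⟩
  let ι := ((Finset.univ.erase b).erase a : Finset α)
  have hι : ∀ i : ι, i.1 ≠ a ∧ i.1 ≠ b := fun i => by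
    obtain ⟨h1, h2⟩ := Finset.mem_erase.1 i.2
    exact ⟨h1, (Finset.mem_erase.1 h2).1⟩
  have hιc : (Finset.univ : Finset ι).card + 2 = Fintype.card α := by
    rw [Finset.card_univ, Fintype.card_coe, Finset.card_erase_of_mem (by simpa using hab),
      Finset.card_erase_of_mem (Finset.mem_univ b), Finset.card_univ]
    have := Fintype.one_lt_card (α := α)
    omega
  let x : ι → alternatingGroup α := fun i =>
    ⟨swap a b * swap b i, swap_mul_swap_mem_alternatingGroup hab (hι i).2.symm⟩
  have hx3 : ∀ i, x i * x i * x i = 1 := fun i =>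
    Subtype.ext (threeCycle_cube hab (hι i).1 (hι i).2)
  have hlift : ∀ i, ∃ y : B, q y = x i ∧ y * y * y = 1 := by
    intro i
    obtain ⟨e, he⟩ := hq (x i)
    have h3 : q (e * e * e) = 1 := by rw [map_mul, map_mul, he, hx3]
    -- Since `e³` lies in the kernel, `e⁶ = 1`; so `e⁴` is another lift and its cube `e¹²` is `1`.
    refine ⟨e * (e * e * e), by rw [map_mul, h3, mul_one, he], ?_⟩
    have h6 := (hK _ h3).1
    calc e * (e * e * e) * (e * (e * e * e)) * (e * (e * e * e))
        = (e * e * e * (e * e * e)) * (e * e * e * (e * e * e)) := by simp only [mul_assoc]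
      _ = 1 := by rw [h6, one_mul]
  choose y hyq hy3 using hlift
  have hy2 : ∀ i j, i ≠ j → y i * y j * (y i * y j) = 1 := fun i j hij =>
    h2 i j (hι i).1 (hι i).2 (hι j).1 (hι j).2 (fun h => hij (Subtype.ext h)) _ (by
      rw [map_mul, hyq, hyq]
      exact threeCycle_mul_threeCycle (hι i).1 (hι i).2)
  obtain ⟨hfin, hcard⟩ := card_closure_of_threeCycle_relations y hy3 hy2 Finset.univ
  set D := Subgroup.closure (y '' (Finset.univ : Finset ι))
  let f : D →* alternatingGroup α := q.comp D.subtype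
  have hf : Function.Surjective f := by
    suffices h : D.map ((alternatingGroup α).subtype.comp q) = alternatingGroup α by
      intro σ
      obtain ⟨d, hd, e⟩ := h.ge σ.2
      exact ⟨⟨d, hd⟩, Subtype.ext e⟩
    refine le_antisymm ?_ fun σ hσ => ?_
    · rintro _ ⟨d, -, rfl⟩
      exact (q d).2
    · rw [MonoidHom.map_closure]
      refine Subgroup.closure_mono ?_ (mem_closure_threeCycles hab hσ)
      rintro _ ⟨i, hia, hib, rfl⟩
      have hi : i ∈ (Finset.univ.erase b).erase a := by simp [hia, hib]
      refine ⟨y ⟨i, hi⟩, ⟨_, by simp, rfl⟩, ?_⟩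
      rw [MonoidHom.comp_apply, hyq]
      rfl
  -- `D` has at most `n!/2` elements and surjects onto `Aₙ`, so it is the image of a section.
  have hbij := hf.bijective_of_nat_card_le (by
    have := two_mul_nat_card_alternatingGroup (α := α)
    rw [hιc] at hcard
    rw [Nat.card_perm, Nat.card_eq_fintype_card (α := α)] at this
    omega)
  let e := MulEquiv.ofBijective f hbij
  exact ⟨D.subtype.comp e.symm.toMonoidHom, fun σ => e.apply_symm_apply σ⟩

/-- Equal cycle types give a conjugating permutation; if it is odd, precomposing with `(a c)`, which
centralises `(a c)(b d)`, makes it even. -/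
theorem exists_conj_swap_mul_swap {c d a' b' i j : α} (hcd : [a, c, b, d].Nodup)
    (hij : [a', i, b', j].Nodup) :
    ∃ π ∈ alternatingGroup α,
      π * (swap a c * swap b d) * π⁻¹ = swap a' i * swap b' j := by
  have hac : a ≠ c := by rintro rfl; simp at hcd
  have hconj := isConj_iff_cycleType_eq.2 ((cycleType_swap_mul_swap_of_nodup hcd).trans
    (cycleType_swap_mul_swap_of_nodup hij).symm)
  have hcomm : swap a c * swap b d = swap b d * swap a c := by
    refine (Perm.disjoint_iff_disjoint_support.2 ?_).commute.eq
    rw [support_swap hac, support_swap (by rintro rfl; simp at hcd)]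
    simp only [List.nodup_cons, List.mem_cons, List.not_mem_nil, not_or] at hcd
    simp only [Finset.disjoint_insert_left, Finset.disjoint_singleton_left, Finset.mem_insert,
      Finset.mem_singleton]
    tauto
  obtain ⟨π, hπ⟩ := isConj_iff.1 hconj
  rcases Int.units_eq_one_or (sign π) with h | h
  · exact ⟨π, h, hπ⟩
  · refine ⟨π * swap a c, ?_, ?_⟩
    · rw [mem_alternatingGroup, Perm.sign_mul, h, sign_swap hac]
      rfl
    · rw [← hπ, mul_inv_rev, swap_inv]
      calc π * swap a c * (swap a c * swap b d) * (swap a c * π⁻¹)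
          = π * (swap a c * (swap a c * swap b d)) * (swap a c * π⁻¹) := by
            simp only [mul_assoc]
        _ = π * (swap b d * swap a c) * π⁻¹ := by
            rw [swap_mul_self_mul]; simp only [mul_assoc]
        _ = _ := by rw [hcomm]

theorem swap_mul_swap_mul_self {c d : α} (hcd : [a, c, b, d].Nodup) :
    swap a c * swap b d * (swap a c * swap b d) = 1 := by
  have h := cycleType_swap_mul_swap_of_nodup hcd
  rw [← pow_two, ← orderOf_dvd_iff_pow_eq_one, ← lcm_cycleType, h]
  decide

/-- In a central extension of `Aₙ` by a group of exponent two, all lifts of products of two disjoint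
transpositions have the same square. -/
theorem sq_eq_sq_of_lift {B : Type*} [Group B] (q : B →* alternatingGroup α)
    (hq : Function.Surjective q) (hK : ∀ k, q k = 1 → k * k = 1 ∧ ∀ g, g * k = k * g)
    {c d a' b' i j : α} (hcd : [a, c, b, d].Nodup) (hij : [a', i, b', j].Nodup) {e f : B}
    (he : (q e : Perm α) = swap a c * swap b d) (hf : (q f : Perm α) = swap a' i * swap b' j) :
    e * e = f * f := by
  obtain ⟨π, hπ, hπe⟩ := exists_conj_swap_mul_swap hcd hij
  obtain ⟨g, hg⟩ := hq ⟨π, hπ⟩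
  have hee : q (e * e) = 1 := Subtype.ext (by
    rw [map_mul, Subgroup.coe_mul, he]
    exact swap_mul_swap_mul_self hcd)
  have hk : q (f⁻¹ * (g * e * g⁻¹)) = 1 := by
    rw [map_mul, map_inv, inv_mul_eq_one]
    apply Subtype.ext
    rw [hf, ← hπe, map_mul, map_mul, map_inv, hg, Subgroup.coe_mul, Subgroup.coe_mul, he]
    rfl
  obtain ⟨hk2, hkc⟩ := hK _ hk
  -- The conjugate of `e` differs from `f` by a central element of square one, so its square is `f *
  -- f`; it is also `e * e`, which is central.
  have h1 : g * e * g⁻¹ = f * (f⁻¹ * (g * e * g⁻¹)) := by group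
  have h2 : g * e * g⁻¹ * (g * e * g⁻¹) = e * e := by
    rw [show g * e * g⁻¹ * (g * e * g⁻¹) = g * (e * e) * g⁻¹ by group, (hK _ hee).2 g,
      mul_inv_cancel_right]
  rw [← h2, h1]
  generalize f⁻¹ * (g * e * g⁻¹) = k at *
  rw [mul_assoc, ← mul_assoc k, ← hkc, mul_assoc f k k, hk2, mul_one]

end ThreeCycles

/-! ### Comparison of double covers through the Baer sum. -/

section Uniqueness

universe v w

variable {A E E' : Type*} [Group A] [Group E] [Group E']

theorem mem_zpowers_iff_of_mul_self {c x : A} (hc : c * c = 1) :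
    x ∈ Subgroup.zpowers c ↔ x = 1 ∨ x = c := by
  have h2 : c ^ (2 : ℤ) = 1 := by rw [zpow_ofNat, pow_two, hc]
  refine ⟨?_, ?_⟩
  · rintro ⟨k, rfl⟩
    rcases Int.even_or_odd' k with ⟨m, rfl | rfl⟩
    · exact Or.inl (by simp only [zpow_mul, h2, one_zpow])
    · exact Or.inr (by simp only [zpow_add, zpow_mul, h2, one_zpow, zpow_one, one_mul])
  · rintro (rfl | rfl)
    · exact Subgroup.one_mem _
    · exact Subgroup.mem_zpowers _

theorem normal_zpowers_of_comm {c : A} (hc : ∀ x, x * c = c * x) :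
    (Subgroup.zpowers c).Normal := ⟨by
  rintro _ ⟨k, rfl⟩ g
  have h : g * c ^ k = c ^ k * g := (show Commute g c from hc g).zpow_right k
  change g * c ^ k * g⁻¹ ∈ _
  rw [h, mul_inv_cancel_right]
  exact Subgroup.zpow_mem _ (Subgroup.mem_zpowers c) k⟩

/-- The kernel is normal with a single non-identity element, which conjugation must fix. -/
theorem IsDoubleCover.exists_central {p : E →* A} (hp : IsDoubleCover p) :
    ∃ c : E, c ≠ 1 ∧ c * c = 1 ∧ (∀ x, x * c = c * x) ∧ ∀ x, p x = 1 ↔ x = 1 ∨ x = c := by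
  obtain ⟨x, y, hxy, huniv⟩ := Nat.card_eq_two_iff.1 hp.2
  obtain ⟨c, hc, hmem⟩ : ∃ c : p.ker, c ≠ 1 ∧ ∀ z : p.ker, z = 1 ∨ z = c := by
    have hall : ∀ z : p.ker, z = x ∨ z = y := fun z => by
      have : z ∈ ({x, y} : Set p.ker) := huniv ▸ Set.mem_univ z
      simpa using this
    rcases hall 1 with h | h
    · exact ⟨y, fun e => hxy (h.symm.trans e.symm), fun z => by rw [h]; exact hall z⟩
    · exact ⟨x, fun e => hxy (e.trans h), fun z => by rw [h]; exact (hall z).symm⟩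
  have hc1 : (c : E) ≠ 1 := fun e => hc (Subtype.ext e)
  have hker : ∀ x, p x = 1 ↔ x = 1 ∨ x = c := by
    intro x
    refine ⟨fun hx => ?_, ?_⟩
    · rcases hmem ⟨x, hx⟩ with h | h
      · exact Or.inl (congrArg Subtype.val h)
      · exact Or.inr (congrArg Subtype.val h)
    · rintro (rfl | rfl)
      · exact map_one p
      · exact c.2
  have hpc : p c = 1 := c.2
  refine ⟨c, hc1, ?_, fun x => ?_, hker⟩
  · rcases (hker (c * c)).1 (by rw [map_mul, hpc, one_mul]) with h | h
    · exact h
    · exact absurd (mul_eq_left.1 h) hc1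
  · have : p (x * c * x⁻¹) = 1 := by rw [map_mul, map_mul, hpc, map_inv]; simp
    rcases (hker _).1 this with h | h
    · rw [mul_inv_eq_one] at h
      exact absurd (mul_eq_left.1 h) hc1
    · rwa [mul_inv_eq_iff_eq_mul] at h

theorem isDoubleCover_of_central {p : E →* A} (hp : Function.Surjective p) {c : E} (hc : c ≠ 1)
    (hker : ∀ x, p x = 1 ↔ x = 1 ∨ x = c) : IsDoubleCover p := by
  have hpc : p c = 1 := (hker c).2 (Or.inr rfl)
  refine ⟨hp, Nat.card_eq_two_iff.2 ⟨1, ⟨c, hpc⟩, fun e => hc (congrArg Subtype.val e).symm, ?_⟩⟩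
  ext ⟨x, hx⟩
  simpa [Subtype.ext_iff] using (hker x).1 hx

theorem CoverIso.sq_eq_one_iff {p : E →* A} {p' : E' →* A} (h : CoverIso p p') {σ : A} :
    (∀ e, p e = σ → e * e = 1) ↔ (∀ e, p' e = σ → e * e = 1) := by
  obtain ⟨φ, hφ⟩ := h
  refine ⟨fun h e he => ?_, fun h e he => ?_⟩
  · have := h (φ.symm e) (by rw [← hφ, φ.apply_symm_apply, he])
    rwa [← map_mul, MulEquiv.map_eq_one_iff] at this
  · have := h (φ e) (by rw [hφ, he])
    rwa [← map_mul, MulEquiv.map_eq_one_iff] at this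

/-- Two double covers of `A` are isomorphic if their Baer sum, the quotient of their fibre product
by the diagonal central element of order two, splits. -/
theorem coverIso_of_section {E : Type v} {E' : Type w} [Group E] [Group E'] {p : E →* A}
    {p' : E' →* A} (hp : IsDoubleCover p) (hp' : IsDoubleCover p')
    (hs : ∀ (B : Type (max v w)) [Group B] (q : B →* A) (π : fibreProduct p p' →* B),
      Function.Surjective q → (∀ k, q k = 1 → k * k = 1 ∧ ∀ g, g * k = k * g) →
      Function.Surjective π → (∀ f, q (π f) = p f.1.1) →
      -- This describes the diagonal subgroup `{1, (c, c')}` without naming the central elements.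
      (∀ f, π f = 1 ↔ f = 1 ∨ f.1.1 ≠ 1 ∧ f.1.2 ≠ 1 ∧ p f.1.1 = 1) →
      ∃ s : A →* B, ∀ σ, q (s σ) = σ) :
    CoverIso p p' := by
  obtain ⟨c, hc1, hcc, hcomm, hker⟩ := hp.exists_central
  obtain ⟨c', hc1', hcc', hcomm', hker'⟩ := hp'.exists_central
  have hpc : p c = 1 := (hker c).2 (Or.inr rfl)
  have hpc' : p' c' = 1 := (hker' c').2 (Or.inr rfl)
  have hF : ∀ f : fibreProduct p p', p f.1.1 = p' f.1.2 := fun f => f.2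
  let κ : fibreProduct p p' := ⟨(c, c'), hpc.trans hpc'.symm⟩
  have hκκ : κ * κ = 1 := Subtype.ext (Prod.ext hcc hcc')
  have hκcomm : ∀ f, f * κ = κ * f := fun f => Subtype.ext (Prod.ext (hcomm _) (hcomm' _))
  let N : Subgroup (fibreProduct p p') := Subgroup.zpowers κ
  have hN : ∀ f, f ∈ N ↔ f = 1 ∨ f = κ := fun f => mem_zpowers_iff_of_mul_self hκκ
  have hNn : N.Normal := normal_zpowers_of_comm hκcomm
  let q₀ : fibreProduct p p' →* A := p.comp (pullbackCover p p')
  have hNq : ∀ f ∈ N, q₀ f = 1 := by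
    intro f hf
    rcases (hN f).1 hf with rfl | rfl
    · exact map_one _
    · exact hpc
  let q : fibreProduct p p' ⧸ N →* A := QuotientGroup.lift N q₀ hNq
  let π : fibreProduct p p' →* fibreProduct p p' ⧸ N := QuotientGroup.mk' N
  have hqπ : ∀ f, q (π f) = p f.1.1 := fun f => rfl
  have hπ1 : ∀ f, π f = 1 ↔ f = 1 ∨ f = κ := fun f => by
    rw [← hN]
    exact QuotientGroup.eq_one_iff f
  have hπs : Function.Surjective π := QuotientGroup.mk'_surjective N
  obtain ⟨s, hs⟩ := hs _ q π (fun σ => by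
      obtain ⟨x, rfl⟩ := hp.1 σ
      obtain ⟨y, hy⟩ := hp'.1 (p x)
      exact ⟨π ⟨(x, y), hy.symm⟩, rfl⟩) (fun k hk => by
      obtain ⟨f, rfl⟩ := hπs k
      rw [hqπ] at hk
      have h1 := (hker _).1 hk
      have h2 := (hker' _).1 ((hF f).symm.trans hk)
      refine ⟨?_, fun g => ?_⟩
      · rw [← map_mul, hπ1]
        refine Or.inl (Subtype.ext (Prod.ext ?_ ?_))
        · change f.1.1 * f.1.1 = 1
          rcases h1 with h | h <;> simp [h, hcc]
        · change f.1.2 * f.1.2 = 1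
          rcases h2 with h | h <;> simp [h, hcc']
      · obtain ⟨g, rfl⟩ := hπs g
        rw [← map_mul, ← map_mul]
        refine congrArg π (Subtype.ext (Prod.ext ?_ ?_))
        · change g.1.1 * f.1.1 = f.1.1 * g.1.1
          rcases h1 with h | h <;> simp [h, hcomm]
        · change g.1.2 * f.1.2 = f.1.2 * g.1.2
          rcases h2 with h | h <;> simp [h, hcomm']) hπs hqπ (fun f => by
      rw [hπ1]
      refine or_congr_right ⟨?_, fun ⟨h1, h2, h3⟩ => ?_⟩
      · rintro rfl
        exact ⟨hc1, hc1', hpc⟩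
      · exact Subtype.ext (Prod.ext (((hker _).1 h3).resolve_left h1)
          (((hker' _).1 ((hF f).symm.trans h3)).resolve_left h2)))
  -- `D` is the preimage of the image of `s`, and will be the graph of the isomorphism: both
  -- projections from it are bijective.
  let D : Subgroup (fibreProduct p p') := π.eqLocus (s.comp q₀)
  have hD : ∀ f, f ∈ D ↔ π f = s (p f.1.1) := fun f => Iff.rfl
  have hexists : ∀ f : fibreProduct p p', f ∈ D ∨
      (⟨(c, 1), hpc.trans (map_one p').symm⟩ : fibreProduct p p') * f ∈ D := by
    intro f
    -- A lift `g` of `s (p f.1.1)` differs from `f` by an element of `{1, c} × {1, c'}`, and `D`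
    -- contains `κ = (c, c')`.
    obtain ⟨g, hg⟩ := hπs (s (p f.1.1))
    have hpg : p g.1.1 = p f.1.1 := by rw [← hqπ, hg, hs]
    have hg' : g ∈ D := by rw [hD, hg, hpg]
    have hκg : κ * g ∈ D := D.mul_mem (by
      rw [hD, (hπ1 κ).2 (Or.inr rfl), hpc, map_one]) hg'
    have h1 : g.1.1 = f.1.1 ∨ g.1.1 = c * f.1.1 := by
      have := (hker (g.1.1 * f.1.1⁻¹)).1 (by rw [map_mul, map_inv, hpg, mul_inv_cancel])
      rwa [mul_inv_eq_one, mul_inv_eq_iff_eq_mul] at this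
    have h2 : g.1.2 = f.1.2 ∨ g.1.2 = c' * f.1.2 := by
      have := (hker' (g.1.2 * f.1.2⁻¹)).1 (by
        rw [map_mul, map_inv, ← hF, ← hF, hpg, mul_inv_cancel])
      rwa [mul_inv_eq_one, mul_inv_eq_iff_eq_mul] at this
    rcases h1 with h1 | h1 <;> rcases h2 with h2 | h2
    · left
      rwa [show f = g from Subtype.ext (Prod.ext h1.symm h2.symm)]
    · right
      convert hκg using 1
      exact Subtype.ext (Prod.ext (congrArg (c * ·) h1.symm) (show 1 * f.1.2 = c' * g.1.2 by
        rw [h2, ← mul_assoc, hcc']))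
    · right
      convert hg' using 1
      exact Subtype.ext (Prod.ext h1.symm (show 1 * f.1.2 = g.1.2 by rw [h2, one_mul]))
    · left
      convert hκg using 1
      exact Subtype.ext (Prod.ext (show f.1.1 = c * g.1.1 by rw [h1, ← mul_assoc, hcc, one_mul])
        (show f.1.2 = c' * g.1.2 by rw [h2, ← mul_assoc, hcc', one_mul]))
  have hDker : ∀ f ∈ D, p f.1.1 = 1 → f = 1 ∨ f = κ := fun f hf h => by
    rwa [hD, h, map_one, hπ1] at hf
  let F₁ : D →* E := (MonoidHom.fst E E').comp ((fibreProduct p p').subtype.comp D.subtype)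
  let F₂ : D →* E' := (MonoidHom.snd E E').comp ((fibreProduct p p').subtype.comp D.subtype)
  have hF₁ : Function.Bijective F₁ := by
    refine ⟨(injective_iff_map_eq_one F₁).2 fun f hf => ?_, fun x => ?_⟩
    · have hf' : f.1.1.1 = 1 := hf
      rcases hDker f.1 f.2 (by rw [hf', map_one]) with h | h
      · exact Subtype.ext h
      · rw [h] at hf'
        exact absurd hf' hc1
    · obtain ⟨y, hy⟩ := hp'.1 (p x)
      rcases hexists ⟨(x, y), hy.symm⟩ with h | h
      · exact ⟨⟨_, h⟩, rfl⟩
      · refine ⟨⟨κ * (⟨(c, 1), hpc.trans (map_one p').symm⟩ * ⟨(x, y), hy.symm⟩),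
          D.mul_mem (by rw [hD, (hπ1 κ).2 (Or.inr rfl), hpc, map_one]) h⟩, ?_⟩
        change c * (c * x) = x
        rw [← mul_assoc, hcc, one_mul]
  have hF₂ : Function.Bijective F₂ := by
    refine ⟨(injective_iff_map_eq_one F₂).2 fun f hf => ?_, fun y => ?_⟩
    · have hf' : f.1.1.2 = 1 := hf
      rcases hDker f.1 f.2 (by rw [hF, hf', map_one]) with h | h
      · exact Subtype.ext h
      · rw [h] at hf'
        exact absurd hf' hc1'
    · obtain ⟨x, hx⟩ := hp.1 (p' y)
      rcases hexists ⟨(x, y), hx⟩ with h | h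
      · exact ⟨⟨_, h⟩, rfl⟩
      · exact ⟨⟨_, h⟩, one_mul y⟩
  refine ⟨(MulEquiv.ofBijective F₁ hF₁).symm.trans (MulEquiv.ofBijective F₂ hF₂), fun x => ?_⟩
  obtain ⟨f, rfl⟩ := hF₁.2 x
  have : (MulEquiv.ofBijective F₁ hF₁).symm (F₁ f) = f :=
    (MulEquiv.ofBijective F₁ hF₁).symm_apply_apply f
  rw [MulEquiv.trans_apply, this]
  exact (hF f.1).symm

/-- Two double covers of `Aₙ` are isomorphic as soon as the lifts of products of two disjoint
transpositions to them have the same order. -/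
theorem coverIso_of_sq_eq_one_iff {E : Type v} {E' : Type w} [Group E] [Group E']
    {α : Type*} [Fintype α] [DecidableEq α]
    {p : E →* alternatingGroup α} {p' : E' →* alternatingGroup α}
    (hp : IsDoubleCover p) (hp' : IsDoubleCover p')
    (h : ∀ a b i j : α, [a, i, b, j].Nodup → ∀ e f,
      (p e : Equiv.Perm α) = Equiv.swap a i * Equiv.swap b j →
      (p' f : Equiv.Perm α) = Equiv.swap a i * Equiv.swap b j → (e * e = 1 ↔ f * f = 1)) :
    CoverIso p p' := by
  refine coverIso_of_section hp hp' fun B _ q π hq hK hπ hqπ hker => ?_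
  rcases subsingleton_or_nontrivial α with hα | hα
  · exact ⟨1, fun σ => Subsingleton.elim _ _⟩
  · obtain ⟨a, b, hab⟩ := exists_pair_ne α
    refine exists_section_of_sq_eq_one q hq hK hab fun i j hia hib hja hjb hij e he => ?_
    have hnd : [a, i, b, j].Nodup := by
      simp [hab, hia.symm, hib, hja.symm, hjb.symm, hij]
    obtain ⟨⟨⟨x, y⟩, hxy⟩, rfl⟩ := hπ e
    have hxy' : p x = p' y := hxy
    rw [hqπ] at he
    have hx := hxy' ▸ he
    have := h a b i j hnd x y he hx
    rw [← map_mul, hker]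
    have hpx : p (x * x) = 1 := Subtype.ext (by
      rw [map_mul, Subgroup.coe_mul, he]
      exact swap_mul_swap_mul_self hnd)
    -- The squares of `x` and `y` are both trivial or both non-trivial; in the second case the pair
    -- is the diagonal central element, which dies in the Baer sum.
    by_cases h1 : x * x = 1
    · exact Or.inl (Subtype.ext (Prod.ext h1 (this.1 h1)))
    · exact Or.inr ⟨h1, fun e => h1 (this.2 e), hpx⟩

end Uniqueness

open Matrix CliffordAlgebra

/-! ### Unit vectors along the roots `e_a - e_b`. -/

section Roots

variable {n : ℕ}

/-- The unit vector `(e_a - e_b) / √2`. -/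
noncomputable def unitRoot (a b : Fin n) : Fin n → ℝ :=
  (√2)⁻¹ • (Pi.single a 1 - Pi.single b 1)

theorem unitRoot_dotProduct (a b : Fin n) (v : Fin n → ℝ) :
    unitRoot a b ⬝ᵥ v = (√2)⁻¹ * (v a - v b) := by
  simp [unitRoot, sub_dotProduct]

theorem sqrt_two_inv_mul_self : (√2 : ℝ)⁻¹ * (√2)⁻¹ = 1 / 2 := by
  rw [← mul_inv, Real.mul_self_sqrt (by norm_num)]
  norm_num

theorem unitRoot_dotProduct_unitRoot (a b c d : Fin n) :
    unitRoot a b ⬝ᵥ unitRoot c d = 1 / 2 * ((if a = c then 1 else 0) - (if a = d then 1 else 0) -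
      (if b = c then 1 else 0) + (if b = d then 1 else 0)) := by
  rw [unitRoot_dotProduct, ← sqrt_two_inv_mul_self]
  simp only [unitRoot, Pi.smul_apply, Pi.sub_apply, Pi.single_apply, smul_eq_mul]
  ring

theorem stdForm_unitRoot {a b : Fin n} (h : a ≠ b) : stdForm n (unitRoot a b) = 1 := by
  rw [stdForm_apply, unitRoot_dotProduct_unitRoot]
  simp [h, h.symm]
  norm_num

end Roots

/-! ### The kernel of `S̃ₙ → Sₙ` has at most two elements. -/

section PresentationKernel

open scoped Nat

variable {n : ℕ}

/-- The central generator `z` of `S̃ₙ`. -/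
def zTilde (n : ℕ) : STilde n := PresentedGroup.of Gen.z

/-- The generator `tᵢ` of `S̃ₙ`. -/
def tTilde (i : Fin (n - 1)) : STilde n := PresentedGroup.of (Gen.t i)

theorem relator_eq_one {r : FreeGroup (Gen n)} (h : Rel n r) :
    (PresentedGroup.mk {r | Rel n r} r : STilde n) = 1 :=
  PresentedGroup.one_of_mem h

theorem zTilde_mul_self : zTilde n * zTilde n = 1 := relator_eq_one Rel.z_sq

theorem tTilde_mul_self (i : Fin (n - 1)) : tTilde i * tTilde i = zTilde n :=
  mul_inv_eq_one.1 (relator_eq_one (Rel.t_sq i))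

theorem tTilde_braid (i j : Fin (n - 1)) (h : (j : ℕ) = i + 1) :
    tTilde j * tTilde i * tTilde j = tTilde i * tTilde j * tTilde i :=
  mul_inv_eq_one.1 (relator_eq_one (Rel.braid i j h))

theorem tTilde_comm (i j : Fin (n - 1)) (h : (i : ℕ) + 1 < j ∨ (j : ℕ) + 1 < i) :
    tTilde j * tTilde i = zTilde n * tTilde i * tTilde j :=
  mul_inv_eq_one.1 (relator_eq_one (Rel.comm i j h))

theorem projS_zTilde : projS n (zTilde n) = 1 := PresentedGroup.toGroup.of _

theorem projS_tTilde (i : Fin (n - 1)) : projS n (tTilde i) = adjSwap n i :=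
  PresentedGroup.toGroup.of _

theorem zTilde_comm (g : STilde n) : g * zTilde n = zTilde n * g := by
  have hg : g ∈ Subgroup.closure (Set.range (PresentedGroup.of (rels := {r | Rel n r}))) := by
    rw [PresentedGroup.closure_range_of]
    trivial
  have hz : Subgroup.closure (Set.range (PresentedGroup.of (rels := {r | Rel n r}))) ≤
      Subgroup.centralizer {zTilde n} := by
    rw [Subgroup.closure_le]
    rintro _ ⟨_ | i, rfl⟩
    · exact Subgroup.mem_centralizer_singleton_iff.2 rfl
    · refine Subgroup.mem_centralizer_singleton_iff.2 ?_
      change tTilde i * zTilde n = zTilde n * tTilde i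
      rw [← tTilde_mul_self i, mul_assoc]
  exact Subgroup.mem_centralizer_singleton_iff.1 (hz hg)

theorem projS_surjective (n : ℕ) : Function.Surjective (projS n) := by
  rw [← MonoidHom.range_eq_top]
  obtain _ | m := n
  · exact Subsingleton.elim _ _
  · have h := Subgroup.closure_eq_top_of_mclosure_eq_top
      (Equiv.Perm.mclosure_swap_castSucc_succ m)
    rw [eq_top_iff, ← h, Subgroup.closure_le]
    rintro _ ⟨i, rfl⟩
    exact ⟨tTilde (n := m + 1) i, projS_tTilde (n := m + 1) i⟩

/-- Modulo `z` the relations become the Coxeter relations, so the quotient has at most `n!`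
elements; as it surjects onto `Sₙ`, it is `Sₙ`. -/
theorem mem_ker_projS {x : STilde n} (hx : projS n x = 1) : x = 1 ∨ x = zTilde n := by
  let N : Subgroup (STilde n) := Subgroup.zpowers (zTilde n)
  have hN : ∀ x, x ∈ N → x = 1 ∨ x = zTilde n := fun x =>
    (mem_zpowers_iff_of_mul_self zTilde_mul_self).1
  have hNn : N.Normal := normal_zpowers_of_comm zTilde_comm
  let π : STilde n →* STilde n ⧸ N := QuotientGroup.mk' N
  have hz : π (zTilde n) = 1 := (QuotientGroup.eq_one_iff _).2 (Subgroup.mem_zpowers _)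
  let q : STilde n ⧸ N →* Equiv.Perm (Fin n) := QuotientGroup.lift N (projS n) (by
    intro y hy
    rcases hN y hy with rfl | rfl
    · exact map_one _
    · exact projS_zTilde)
  have hq : Function.Surjective q := fun σ => by
    obtain ⟨y, rfl⟩ := projS_surjective n σ
    exact ⟨π y, rfl⟩
  let s : ℕ → STilde n ⧸ N := fun i => if h : i < n - 1 then π (tTilde ⟨i, h⟩) else 1
  have hs : ∀ i (h : i < n - 1), s i = π (tTilde ⟨i, h⟩) := fun i h => dif_pos h
  obtain ⟨hfin, hcard⟩ := card_closure_of_coxeter_relations s (n - 1)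
    (fun i hi => by rw [hs i hi, ← map_mul, tTilde_mul_self, hz])
    (fun i hi => by
      rw [hs i (by omega), hs (i + 1) hi]
      simp only [← map_mul]
      rw [tTilde_braid _ _ rfl])
    (fun i j hij hj => by
      rw [hs i (by omega), hs j hj, ← map_mul, tTilde_comm _ _ (Or.inl hij), map_mul, map_mul, hz,
        one_mul])
  have htop : Subgroup.closure (s '' Set.Iio (n - 1)) = ⊤ := by
    rw [eq_top_iff, ← MonoidHom.range_eq_top.2 (QuotientGroup.mk'_surjective N),
      MonoidHom.range_eq_map, ← PresentedGroup.closure_range_of, MonoidHom.map_closure,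
      Subgroup.closure_le]
    rintro _ ⟨_, ⟨_ | i, rfl⟩, rfl⟩
    · change π (zTilde n) ∈ _
      rw [hz]
      exact Subgroup.one_mem _
    · exact Subgroup.subset_closure ⟨i, i.2, hs i i.2⟩
  rw [htop] at hfin hcard
  have hfin' : Finite (STilde n ⧸ N) := Finite.of_equiv _ Subgroup.topEquiv.toEquiv
  have hbij := hq.bijective_of_nat_card_le (by
    rw [Subgroup.card_top] at hcard
    refine hcard.trans ?_
    rw [Nat.card_perm, Nat.card_eq_fintype_card, Fintype.card_fin]
    -- For `n = 0` the truncated `n - 1` is `0`, and the bound `1!` equals `0!`.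
    obtain _ | m := n
    · simp
    · exact le_rfl)
  have hπx : π x = 1 := hbij.1 (by rw [map_one]; exact hx)
  exact hN x ((QuotientGroup.eq_one_iff x).1 hπx)

end PresentationKernel

/-! ### A Clifford representation of `S̃ₙ`, showing that `z` is non-trivial. -/

section PinRepresentation

variable {n : ℕ}

theorem ι_neg_mul_self (v : Fin n → ℝ) (hv : stdForm n v = 1) :
    ι (-stdForm n) v * ι (-stdForm n) v = -1 := by
  rw [ι_sq_scalar, _root_.neg_apply, hv, map_neg, map_one]

theorem ι_neg_mul_add_swap (v w : Fin n → ℝ) :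
    ι (-stdForm n) v * ι (-stdForm n) w + ι (-stdForm n) w * ι (-stdForm n) v =
      algebraMap ℝ _ (-(2 * (v ⬝ᵥ w))) := by
  rw [ι_mul_ι_add_swap, ← polar_stdForm]
  congr 1
  simp only [QuadraticMap.polar, _root_.neg_apply]
  ring

/-- A unit vector, as an invertible element of the Clifford algebra of the negative definite
form. -/
noncomputable def unitOfVec (v : Fin n → ℝ) (hv : stdForm n v = 1) :
    (CliffordAlgebra (-stdForm n))ˣ where
  val := ι (-stdForm n) v
  inv := -ι (-stdForm n) v
  val_inv := by rw [mul_neg, ι_neg_mul_self v hv, neg_neg]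
  inv_val := by rw [neg_mul, ι_neg_mul_self v hv, neg_neg]

/-- The images of the generators of `S̃ₙ` in the Clifford algebra. -/
noncomputable def genToClifford (n : ℕ) : Gen n → (CliffordAlgebra (-stdForm n))ˣ
  | Gen.z => -1
  | Gen.t i => unitOfVec (unitRoot ⟨i, by omega⟩ ⟨i + 1, by omega⟩)
      (stdForm_unitRoot (by simp))

theorem genToClifford_rel (n : ℕ) :
    ∀ r ∈ {r | Rel n r}, FreeGroup.lift (genToClifford n) r = 1 := by
  rintro r (_ | i | ⟨i, j, h⟩ | ⟨i, j, h⟩)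
  · simp [genToClifford]
  · simp only [map_mul, map_inv, FreeGroup.lift_apply_of, mul_inv_eq_one]
    exact Units.ext (ι_neg_mul_self _ (stdForm_unitRoot (by simp)))
  · obtain ⟨i, hi⟩ := i
    obtain ⟨j, hj⟩ := j
    simp only at h
    subst h
    simp only [map_mul, map_inv, FreeGroup.lift_apply_of, mul_inv_eq_one]
    apply Units.ext
    simp only [Units.val_mul, genToClifford, unitOfVec]
    set a := unitRoot (⟨i, by omega⟩ : Fin n) ⟨i + 1, by omega⟩
    set b := unitRoot (⟨i + 1, by omega⟩ : Fin n) ⟨i + 1 + 1, by omega⟩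
    have ha : ι (-stdForm n) a * ι (-stdForm n) a = -1 :=
      ι_neg_mul_self _ (stdForm_unitRoot (by simp))
    have hb : ι (-stdForm n) b * ι (-stdForm n) b = -1 :=
      ι_neg_mul_self _ (stdForm_unitRoot (by simp))
    have hab := ι_neg_mul_add_swap a b
    -- Consecutive roots have inner product `-1/2`, so `ab + ba = 1`; with `a² = b² = -1`, both
    -- sides of the braid relation equal `a + b`.
    have hdot : -(2 * (a ⬝ᵥ b)) = 1 := by
      rw [unitRoot_dotProduct_unitRoot]
      simp [show i ≠ i + 1 + 1 by omega]
    rw [hdot, map_one] at hab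
    have hab1 := eq_sub_of_add_eq hab
    rw [mul_assoc, hab1, mul_sub, mul_one, ← mul_assoc, hb, sub_mul, mul_assoc, ha]
    noncomm_ring
  · simp only [map_mul, map_inv, FreeGroup.lift_apply_of, mul_inv_eq_one]
    apply Units.ext
    simp only [Units.val_mul, genToClifford, unitOfVec, Units.val_neg, Units.val_one]
    rw [neg_one_mul, neg_mul, eq_neg_iff_add_eq_zero, ι_neg_mul_add_swap,
      unitRoot_dotProduct_unitRoot]
    have h1 : (j : ℕ) ≠ i := by omega
    have h2 : (j : ℕ) ≠ i + 1 := by omega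
    have h3 : (j : ℕ) + 1 ≠ i := by omega
    simp [h1, h2, h3]

/-- The representation of `S̃ₙ` by unit vectors of the Clifford algebra of the negative definite
form. -/
noncomputable def sTildeToClifford (n : ℕ) : STilde n →* (CliffordAlgebra (-stdForm n))ˣ :=
  PresentedGroup.toGroup (genToClifford_rel n)

theorem zTilde_ne_one : zTilde n ≠ 1 := by
  intro h
  have h1 := congrArg (fun x => ((sTildeToClifford n x : (CliffordAlgebra (-stdForm n))ˣ) :
    CliffordAlgebra (-stdForm n))) h
  simp only [map_one, Units.val_one] at h1
  have h2 : sTildeToClifford n (zTilde n) = -1 := PresentedGroup.toGroup.of _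
  rw [h2, Units.val_neg, Units.val_one, ← map_one (algebraMap ℝ (CliffordAlgebra (-stdForm n))),
    ← map_neg] at h1
  have := (algebraMap ℝ (CliffordAlgebra (-stdForm n))).injective h1
  norm_num at this

theorem projS_eq_one_iff (x : STilde n) : projS n x = 1 ↔ x = 1 ∨ x = zTilde n := by
  refine ⟨mem_ker_projS, ?_⟩
  rintro (rfl | rfl)
  · exact map_one _
  · exact projS_zTilde

theorem isDoubleCover_projS (n : ℕ) : IsDoubleCover (projS n) :=
  isDoubleCover_of_central (projS_surjective n) zTilde_ne_one projS_eq_one_iff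

theorem coe_projA (x : ATilde n) : (projA n x : Equiv.Perm (Fin n)) = projS n x := rfl

theorem isDoubleCover_projA (n : ℕ) : IsDoubleCover (projA n) := by
  have hz : zTilde n ∈ ATilde n := by
    rw [Subgroup.mem_comap, projS_zTilde]
    exact Subgroup.one_mem _
  refine isDoubleCover_of_central (c := ⟨zTilde n, hz⟩) (fun σ => ?_)
    (fun e => zTilde_ne_one (congrArg Subtype.val e)) fun x => ?_
  · obtain ⟨x, hx⟩ := projS_surjective n σ
    exact ⟨⟨x, by rw [Subgroup.mem_comap, hx]; exact σ.2⟩, Subtype.ext hx⟩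
  · rw [Subtype.ext_iff, coe_projA, Subtype.ext_iff, Subtype.ext_iff]
    exact projS_eq_one_iff x.1

/-- Distant generators commute up to `z`, so `(t₀ t₂)² = z t₀² t₂² = z³ = z`. -/
theorem exists_lift_projA_sq_ne_one (h : 4 ≤ n) : ∃ e : ATilde n,
    (projA n e : Equiv.Perm (Fin n)) = Equiv.swap ⟨0, by omega⟩ ⟨1, by omega⟩ *
      Equiv.swap ⟨2, by omega⟩ ⟨3, by omega⟩ ∧ e * e ≠ 1 := by
  let t₀ : STilde n := tTilde ⟨0, by omega⟩
  let t₂ : STilde n := tTilde ⟨2, by omega⟩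
  have hproj : projS n (t₀ * t₂) = Equiv.swap ⟨0, by omega⟩ ⟨1, by omega⟩ *
      Equiv.swap ⟨2, by omega⟩ ⟨3, by omega⟩ := by
    rw [map_mul, projS_tTilde, projS_tTilde]
    rfl
  refine ⟨⟨t₀ * t₂, ?_⟩, hproj, fun e => zTilde_ne_one (n := n) ?_⟩
  · rw [Subgroup.mem_comap, hproj]
    exact swap_mul_swap_mem_alternatingGroup (by simp) (by simp)
  · have h1 : t₀ * t₂ * (t₀ * t₂) = 1 := congrArg Subtype.val e
    have h2 : t₂ * t₀ = zTilde n * t₀ * t₂ := tTilde_comm _ _ (Or.inl (by simp))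
    rw [← h1, mul_assoc, ← mul_assoc t₂, h2, ← mul_assoc, ← mul_assoc, ← mul_assoc,
      zTilde_comm, mul_assoc (zTilde n), tTilde_mul_self, zTilde_mul_self, one_mul,
      tTilde_mul_self]

end PinRepresentation

/-! ### The kernel of `Spinₙ → SOₙ`. -/

section ScalarCriterion

variable {n : ℕ}

/-- Both sides vanish on scalars and obey the same twisted Leibniz rule. For even elements this
turns commuting with all vectors into the vanishing of contractions. -/
theorem ι_mul_sub_involute_mul_ι {R M : Type*} [CommRing R] [AddCommGroup M] [Module R M]
    (Q : QuadraticForm R M) (v : M) (x : CliffordAlgebra Q) :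
    ι Q v * x - involute x * ι Q v = contractLeft (Q := Q) (Q.polarBilin v) x := by
  induction x using CliffordAlgebra.left_induction with
  | algebraMap r => rw [AlgHom.commutes, contractLeft_algebraMap, Algebra.commutes, sub_self]
  | add x y hx hy => rw [map_add, map_add, ← hx, ← hy]; noncomm_ring
  | ι_mul x m hx =>
    rw [contractLeft_ι_mul, ← hx, map_mul, involute_ι, QuadraticMap.polarBilin_apply_apply,
      Algebra.smul_def, ← ι_mul_ι_add_swap]
    noncomm_ring

/-- The Euler operator `∑ eᵢ ∧ (eᵢ* ⌋ ·)` multiplies elements of degree `k` by `k`. -/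
theorem sum_ι_mul_contractLeft {k : ℕ} {y : ExteriorAlgebra ℝ (Fin n → ℝ)}
    (hy : y ∈ ⋀[ℝ]^k (Fin n → ℝ)) :
    ∑ i, ExteriorAlgebra.ι ℝ (Pi.single i (1 : ℝ)) *
      contractLeft (Q := (0 : QuadraticForm ℝ (Fin n → ℝ))) (LinearMap.proj i) y = (k : ℝ) • y := by
  induction hy using Submodule.pow_induction_on_left' with
  | algebraMap r =>
    simp only [Nat.cast_zero, zero_smul]
    refine Finset.sum_eq_zero fun i _ => ?_
    rw [show algebraMap ℝ (ExteriorAlgebra ℝ (Fin n → ℝ)) r =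
      algebraMap ℝ (CliffordAlgebra (0 : QuadraticForm ℝ (Fin n → ℝ))) r from rfl,
      contractLeft_algebraMap, mul_zero]
  | add x y i _ _ hx hy =>
    simp only [map_add, mul_add, Finset.sum_add_distrib, hx, hy, smul_add]
  | mem_mul m hm i x _ hx =>
    obtain ⟨v, rfl⟩ := hm
    have hv : ∑ i, v i • ExteriorAlgebra.ι ℝ (Pi.single i (1 : ℝ)) = ExteriorAlgebra.ι ℝ v := by
      simp only [← map_smul, ← map_sum]
      congr 1
      ext j
      simp [Pi.single_apply]
    have hstep : ∀ i, ExteriorAlgebra.ι ℝ (Pi.single i (1 : ℝ)) *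
        contractLeft (Q := (0 : QuadraticForm ℝ (Fin n → ℝ))) (LinearMap.proj i)
          (ExteriorAlgebra.ι ℝ v * x) =
        (v i • ExteriorAlgebra.ι ℝ (Pi.single i (1 : ℝ))) * x +
        ExteriorAlgebra.ι ℝ v * (ExteriorAlgebra.ι ℝ (Pi.single i (1 : ℝ)) *
          contractLeft (Q := (0 : QuadraticForm ℝ (Fin n → ℝ))) (LinearMap.proj i) x) := by
      intro i
      have h1 := contractLeft_ι_mul (Q := (0 : QuadraticForm ℝ (Fin n → ℝ)))
        (d := LinearMap.proj i) v x
      have h2 : ExteriorAlgebra.ι ℝ (Pi.single i (1 : ℝ)) * ExteriorAlgebra.ι ℝ v =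
          -(ExteriorAlgebra.ι ℝ v * ExteriorAlgebra.ι ℝ (Pi.single i (1 : ℝ))) :=
        eq_neg_of_add_eq_zero_left (ExteriorAlgebra.ι_add_mul_swap _ _)
      refine (congrArg (ExteriorAlgebra.ι ℝ (Pi.single i (1 : ℝ)) * ·) h1).trans ?_
      change ExteriorAlgebra.ι ℝ (Pi.single i (1 : ℝ)) * (v i • x - ExteriorAlgebra.ι ℝ v * _) = _
      rw [mul_sub, ← mul_assoc, h2, mul_smul_comm, smul_mul_assoc, neg_mul, sub_neg_eq_add,
        mul_assoc]
    rw [Finset.sum_congr rfl fun i _ => hstep i, Finset.sum_add_distrib, ← Finset.sum_mul, hv,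
      ← Finset.mul_sum, hx, mul_smul_comm, Nat.cast_succ, add_smul, one_smul, add_comm]

/-- The Euler operator kills `y` but multiplies its degree `j` component by `j`, so only degree zero
survives. -/
theorem mem_range_algebraMap_of_contractLeft_eq_zero {y : ExteriorAlgebra ℝ (Fin n → ℝ)}
    (hy : ∀ d, contractLeft (Q := (0 : QuadraticForm ℝ (Fin n → ℝ))) d y = 0) :
    ∃ r : ℝ, y = algebraMap ℝ _ r := by
  classical
  let 𝒜 : ℕ → Submodule ℝ (ExteriorAlgebra ℝ (Fin n → ℝ)) := fun i => ⋀[ℝ]^i (Fin n → ℝ)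
  let N : ExteriorAlgebra ℝ (Fin n → ℝ) →ₗ[ℝ] ExteriorAlgebra ℝ (Fin n → ℝ) :=
    ∑ i, (LinearMap.mulLeft ℝ (ExteriorAlgebra.ι ℝ (Pi.single i (1 : ℝ)))).comp
      (contractLeft (Q := (0 : QuadraticForm ℝ (Fin n → ℝ))) (LinearMap.proj i))
  have hN : ∀ z, N z = ∑ i, ExteriorAlgebra.ι ℝ (Pi.single i (1 : ℝ)) *
      contractLeft (Q := (0 : QuadraticForm ℝ (Fin n → ℝ))) (LinearMap.proj i) z := fun z => by
    simp only [N, LinearMap.sum_apply]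
    rfl
  have hNy : N y = 0 := by
    rw [hN]
    exact Finset.sum_eq_zero fun i _ => by rw [hy, mul_zero]
  have hcomp : ∀ j : ℕ, j ≠ 0 →
      (DirectSum.decompose 𝒜 y j : ExteriorAlgebra ℝ (Fin n → ℝ)) = 0 := by
    intro j hj
    have h : ∀ z, (DirectSum.decompose 𝒜 (N z) j : ExteriorAlgebra ℝ (Fin n → ℝ)) =
        (j : ℝ) • (DirectSum.decompose 𝒜 z j : ExteriorAlgebra ℝ (Fin n → ℝ)) := by
      intro z
      induction z using DirectSum.Decomposition.inductionOn 𝒜 with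
      | zero => simp
      | homogeneous m =>
        rename_i i
        rw [hN, sum_ι_mul_contractLeft m.2, DirectSum.decompose_smul, DirectSum.smul_apply,
          Submodule.coe_smul]
        by_cases hij : i = j
        · subst hij; rfl
        · rw [DirectSum.decompose_of_mem_ne 𝒜 m.2 hij, smul_zero, smul_zero]
      | add z w hz hw =>
        rw [map_add, DirectSum.decompose_add, DirectSum.decompose_add, DirectSum.add_apply,
          DirectSum.add_apply, Submodule.coe_add, Submodule.coe_add, hz, hw, smul_add]
    have h1 := h y
    rw [hNy, DirectSum.decompose_zero, DirectSum.zero_apply, Submodule.coe_zero] at h1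
    exact (smul_eq_zero.1 h1.symm).resolve_left (by exact_mod_cast hj)
  have hy0 : y = (DirectSum.decompose 𝒜 y 0 : ExteriorAlgebra ℝ (Fin n → ℝ)) := by
    conv_lhs => rw [← DirectSum.sum_support_decompose 𝒜 y]
    refine Finset.sum_eq_single 0 (fun j _ hj => hcomp j hj) fun h => ?_
    simpa using h
  have hmem := (DirectSum.decompose 𝒜 y 0).2
  rw [← hy0] at hmem
  have hmem' : y ∈ (LinearMap.range (ExteriorAlgebra.ι ℝ : (Fin n → ℝ) →ₗ[ℝ] _)) ^ 0 := hmem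
  rw [pow_zero, Submodule.mem_one] at hmem'
  obtain ⟨r, hr⟩ := hmem'
  exact ⟨r, hr.symm⟩

/-- An even element of the Clifford algebra commuting with all vectors is a scalar. -/
theorem exists_algebraMap_of_commute {x : CliffordAlgebra (stdForm n)} (hx : involute x = x)
    (hcomm : ∀ v, x * ι (stdForm n) v = ι (stdForm n) v * x) :
    ∃ r : ℝ, x = algebraMap ℝ _ r := by
  have hc : ∀ d, contractLeft (Q := stdForm n) d x = 0 := by
    intro d
    -- The polar form is twice the dot product, so every functional is half the polar form with its
    -- coordinate vector.
    have hd : d = (1 / 2 : ℝ) • (stdForm n).polarBilin (fun i => d (Pi.single i 1)) := by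
      ext i
      simp [polar_stdForm, dotProduct_single]
    rw [hd, map_smul, LinearMap.smul_apply, ← ι_mul_sub_involute_mul_ι, hx, hcomm, sub_self,
      smul_zero]
  -- `equivExterior` commutes with contractions and fixes scalars, which moves the question to the
  -- graded exterior algebra.
  obtain ⟨r, hr⟩ := mem_range_algebraMap_of_contractLeft_eq_zero (y := equivExterior (stdForm n) x)
    (fun d => by
      rw [equivExterior, changeFormEquiv_apply, ← changeForm_contractLeft, hc, map_zero])
  refine ⟨r, (equivExterior (stdForm n)).injective (hr.trans ?_)⟩
  rw [equivExterior, changeFormEquiv_apply, changeForm_algebraMap]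

/-- Such an `x` is even and commutes with all vectors, so it is a scalar `r`, and `x * star x = 1`
gives `r² = 1`. -/
theorem eq_one_or_eq_neg_one_of_spinToSO_eq_one {x : Spin n} (hx : spinToSO n x = 1) :
    (x : CliffordAlgebra (stdForm n)) = 1 ∨ (x : CliffordAlgebra (stdForm n)) = -1 := by
  have hinv' : ((x⁻¹ : Spin n) : CliffordAlgebra (stdForm n)) * x = 1 :=
    spinGroup.coe_star_mul_self x
  obtain ⟨r, hr⟩ := exists_algebraMap_of_commute (spinGroup.involute_eq x.2) fun v => by
    have h := spinToSO_spec x v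
    rw [hx, Submonoid.coe_one, one_mulVec] at h
    conv_rhs => rw [h, mul_assoc, hinv', mul_one]
  have hmul : (x : CliffordAlgebra (stdForm n)) * star (x : CliffordAlgebra (stdForm n)) = 1 :=
    spinGroup.coe_mul_star_self x
  rw [hr, star_algebraMap, ← map_mul,
    ← map_one (algebraMap ℝ (CliffordAlgebra (stdForm n)))] at hmul
  have hr2 := (algebraMap ℝ (CliffordAlgebra (stdForm n))).injective hmul
  rw [hr]
  rcases mul_self_eq_one_iff.1 hr2 with rfl | rfl
  · exact Or.inl (map_one _)
  · exact Or.inr (by rw [map_neg, map_one])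

end ScalarCriterion

/-! ### The pullback of the spin cover to `Aₙ`. -/

section SpinCover

variable {n : ℕ}

theorem ι_mul_self_of_unit {u : Fin n → ℝ} (hu : stdForm n u = 1) :
    ι (stdForm n) u * ι (stdForm n) u = 1 := by
  rw [ι_sq_scalar, hu, map_one]

theorem ι_mul_ι_mem_spinGroup {u v : Fin n → ℝ} (hu : stdForm n u = 1) (hv : stdForm n v = 1) :
    ι (stdForm n) u * ι (stdForm n) v ∈ spinGroup (stdForm n) := by
  have hmem : ∀ {u : Fin n → ℝ} (hu : stdForm n u = 1),
      (⟨ι (stdForm n) u, ι (stdForm n) u, ι_mul_self_of_unit hu, ι_mul_self_of_unit hu⟩ :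
        (CliffordAlgebra (stdForm n))ˣ) ∈ lipschitzGroup (stdForm n) := fun {u} hu =>
    Subgroup.subset_closure ⟨u, rfl⟩
  refine spinGroup.mem_iff.2 ⟨pinGroup.mem_iff.2 ⟨⟨_, mul_mem (hmem hu) (hmem hv), rfl⟩, ?_⟩, ?_⟩
  · have hs : star (ι (stdForm n) u * ι (stdForm n) v) = ι (stdForm n) v * ι (stdForm n) u := by
      rw [star_mul, star_ι, star_ι, neg_mul_neg]
    rw [Unitary.mem_iff, hs]
    constructor
    · rw [mul_assoc, ← mul_assoc (ι (stdForm n) u), ι_mul_self_of_unit hu, one_mul,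
        ι_mul_self_of_unit hv]
    · rw [mul_assoc, ← mul_assoc (ι (stdForm n) v), ι_mul_self_of_unit hv, one_mul,
        ι_mul_self_of_unit hu]
  · exact ι_mul_ι_mem_evenOdd_zero _ _ _

theorem reflMatrix_unitRoot_mulVec {a b : Fin n} (hab : a ≠ b) (w : Fin n → ℝ) :
    reflMatrix (unitRoot a b) *ᵥ w = w ∘ Equiv.swap a b := by
  rw [reflMatrix_mulVec, stdForm_unitRoot hab, unitRoot_dotProduct, unitRoot, smul_smul]
  have h : 2 / 1 * ((√2 : ℝ)⁻¹ * (w a - w b)) * (√2)⁻¹ = w a - w b := by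
    linear_combination (2 * (w a - w b)) * sqrt_two_inv_mul_self
  rw [h]
  ext i
  by_cases hia : i = a
  · subst hia
    simp [hab]
  · by_cases hib : i = b
    · subst hib
      simp [hia]
    · simp [hia, hib, Equiv.swap_apply_of_ne_of_ne hia hib]

/-- The lift to `Spinₙ(ℝ)` of a product of two transpositions. -/
noncomputable def spinLift {a b c d : Fin n} (hab : a ≠ b) (hcd : c ≠ d) : Spin n :=
  ⟨ι (stdForm n) (unitRoot a b) * ι (stdForm n) (unitRoot c d),
    ι_mul_ι_mem_spinGroup (stdForm_unitRoot hab) (stdForm_unitRoot hcd)⟩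

/-- Conjugation by a unit vector is minus the reflection in it, and the two signs cancel. Reflection
in a root permutes coordinates by a transposition. -/
theorem spinToSO_spinLift {a b c d : Fin n} (hab : a ≠ b) (hcd : c ≠ d) :
    spinToSO n (spinLift hab hcd) = altToSO n ⟨Equiv.swap a b * Equiv.swap c d,
      swap_mul_swap_mem_alternatingGroup hab hcd⟩ := by
  refine SO_ext fun w => ?_
  have hinv : (spinLift hab hcd : CliffordAlgebra (stdForm n)) *
      ((spinLift hab hcd)⁻¹ : Spin n) = 1 := spinGroup.coe_mul_star_self _
  have hu : stdForm n (unitRoot a b) ≠ 0 := by rw [stdForm_unitRoot hab]; exact one_ne_zero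
  have hv : stdForm n (unitRoot c d) ≠ 0 := by rw [stdForm_unitRoot hcd]; exact one_ne_zero
  have h1 := ι_mul_refl (unitRoot c d) w hv
  have h2 := ι_mul_refl (unitRoot a b) (reflMatrix (unitRoot c d) *ᵥ w) hu
  have key : (spinLift hab hcd : CliffordAlgebra (stdForm n)) * ι (stdForm n) w =
      ι (stdForm n) (reflMatrix (unitRoot a b) *ᵥ (reflMatrix (unitRoot c d) *ᵥ w)) *
        spinLift hab hcd := by
    change ι (stdForm n) (unitRoot a b) * ι (stdForm n) (unitRoot c d) * _ =
      _ * (ι (stdForm n) (unitRoot a b) * ι (stdForm n) (unitRoot c d))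
    rw [← mul_assoc, ← h2, mul_assoc (-_), ← h1]
    noncomm_ring
  rw [spinToSO_spec, key, mul_assoc, hinv, mul_one, reflMatrix_unitRoot_mulVec hcd,
    reflMatrix_unitRoot_mulVec hab]
  congr 1
  change _ = ((Equiv.swap a b * Equiv.swap c d)⁻¹).permMatrix ℝ *ᵥ w
  rw [permMatrix_mulVec, _root_.mul_inv_rev, Equiv.swap_inv, Equiv.swap_inv]
  rfl

/-- Roots with disjoint supports are orthogonal, so the unit vectors `u`, `v` anticommute and `uvuv
= -u²v² = -1`. -/
theorem spinLift_mul_self {a b c d : Fin n} (h : [a, b, c, d].Nodup) (hab : a ≠ b) (hcd : c ≠ d) :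
    ((spinLift hab hcd * spinLift hab hcd : Spin n) : CliffordAlgebra (stdForm n)) = -1 := by
  have hdot : unitRoot a b ⬝ᵥ unitRoot c d = 0 := by
    simp only [List.nodup_cons, List.mem_cons, List.not_mem_nil, not_or] at h
    rw [unitRoot_dotProduct_unitRoot]
    simp [h]
  have hanti := ι_mul_ι_add_swap (Q := stdForm n) (unitRoot a b) (unitRoot c d)
  rw [polar_stdForm, hdot, mul_zero, map_zero] at hanti
  change ι (stdForm n) (unitRoot a b) * ι (stdForm n) (unitRoot c d) *
    (ι (stdForm n) (unitRoot a b) * ι (stdForm n) (unitRoot c d)) = -1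
  nth_rewrite 2 [eq_neg_of_add_eq_zero_left hanti]
  rw [mul_neg, mul_assoc, ← mul_assoc (ι (stdForm n) (unitRoot c d)),
    ι_mul_self_of_unit (stdForm_unitRoot hcd), one_mul, ι_mul_self_of_unit (stdForm_unitRoot hab)]

/-- It suffices to lift the generating three-cycles, which are products of two transpositions;
surjectivity of `Spinₙ → SOₙ` is not needed. -/
theorem exists_spinToSO_eq_altToSO (hn : 2 ≤ n) (σ : alternatingGroup (Fin n)) :
    ∃ x, spinToSO n x = altToSO n σ := by
  have h01 : (⟨0, by omega⟩ : Fin n) ≠ ⟨1, by omega⟩ := by simp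
  have hle : alternatingGroup (Fin n) ≤
      ((spinToSO n).range.comap (altToSO n)).map (alternatingGroup (Fin n)).subtype := by
    intro τ hτ
    refine (Subgroup.closure_le _).2 ?_ (mem_closure_threeCycles h01 hτ)
    rintro _ ⟨i, -, hi, rfl⟩
    exact ⟨⟨_, swap_mul_swap_mem_alternatingGroup h01 hi.symm⟩,
      ⟨_, spinToSO_spinLift h01 hi.symm⟩, rfl⟩
  obtain ⟨τ, ⟨x, hx⟩, hτ⟩ := hle σ.2
  exact ⟨x, hx.trans (congrArg _ (Subtype.ext hτ))⟩

theorem exists_lift_spinCoverA_sq (hn : 4 ≤ n) :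
    ∃ e : fibreProduct (altToSO n) (spinToSO n),
      (spinCoverA n e : Equiv.Perm (Fin n)) = Equiv.swap ⟨0, by omega⟩ ⟨1, by omega⟩ *
        Equiv.swap ⟨2, by omega⟩ ⟨3, by omega⟩ ∧
      (((e * e).1.2 : Spin n) : CliffordAlgebra (stdForm n)) = -1 := by
  have h01 : (⟨0, by omega⟩ : Fin n) ≠ ⟨1, by omega⟩ := by simp
  have h23 : (⟨2, by omega⟩ : Fin n) ≠ ⟨3, by omega⟩ := by simp
  exact ⟨⟨(⟨_, swap_mul_swap_mem_alternatingGroup h01 h23⟩, spinLift h01 h23),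
    (spinToSO_spinLift h01 h23).symm⟩, rfl, spinLift_mul_self (by simp) h01 h23⟩

theorem neg_one_ne_one_clifford : (-1 : CliffordAlgebra (stdForm n)) ≠ 1 := by
  rw [← map_one (algebraMap ℝ (CliffordAlgebra (stdForm n))), ← map_neg]
  intro h
  have := (algebraMap ℝ (CliffordAlgebra (stdForm n))).injective h
  norm_num at this

/-- The non-trivial kernel element is obtained as the square of a lift of `(0 1)(2 3)`; this also
shows that `-1` lies in `Spinₙ`. -/
theorem isDoubleCover_spinCoverA (hn : 4 ≤ n) : IsDoubleCover (spinCoverA n) := by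
  obtain ⟨e, he, he2⟩ := exists_lift_spinCoverA_sq hn
  have hee : spinCoverA n (e * e) = 1 := Subtype.ext (by
    rw [map_mul, Subgroup.coe_mul, he]
    exact swap_mul_swap_mul_self (by simp))
  refine isDoubleCover_of_central (c := e * e) (fun σ => ?_) (fun h => ?_) fun x =>
    ⟨fun hx => ?_, ?_⟩
  · obtain ⟨x, hx⟩ := exists_spinToSO_eq_altToSO (by omega) σ
    exact ⟨⟨(σ, x), hx.symm⟩, rfl⟩
  · rw [h] at he2
    exact neg_one_ne_one_clifford he2.symm
  · have hx1 : x.1.1 = 1 := hx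
    have hx2 : spinToSO n x.1.2 = 1 := by
      rw [← (show altToSO n x.1.1 = spinToSO n x.1.2 from x.2), hx1, map_one]
    rcases eq_one_or_eq_neg_one_of_spinToSO_eq_one hx2 with h | h
    · exact Or.inl (Subtype.ext (Prod.ext hx1 (Subtype.ext h)))
    · exact Or.inr (Subtype.ext (Prod.ext (hx1.trans hee.symm) (Subtype.ext (h.trans he2.symm))))
  · rintro (rfl | rfl)
    · exact map_one _
    · exact hee

end SpinCover

/-! ### Classification by squares of lifts of double transpositions. -/

section Main

variable {n : ℕ} {E E' : Type*} [Group E] [Group E']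

theorem isDoubleCover_fst (A : Type*) [Group A] :
    IsDoubleCover (MonoidHom.fst A (Multiplicative (ZMod 2))) := by
  refine isDoubleCover_of_central (c := (1, Multiplicative.ofAdd 1)) (fun a => ⟨(a, 1), rfl⟩)
    (by simp) ?_
  rintro ⟨a, b⟩
  have hb : b = 1 ∨ b = Multiplicative.ofAdd 1 := by revert b; decide
  simp only [MonoidHom.coe_fst, Prod.mk.injEq, Prod.mk_eq_one]
  tauto

theorem fst_mul_self_eq_one {A : Type*} [Group A] {e : A × Multiplicative (ZMod 2)}
    (h : e.1 * e.1 = 1) : e * e = 1 :=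
  Prod.ext h ((by decide : ∀ b : Multiplicative (ZMod 2), b * b = 1) e.2)

theorem IsDoubleCover.sq_eq_sq_of_lift {α : Type*} [Fintype α] [DecidableEq α]
    {p : E →* alternatingGroup α} (hp : IsDoubleCover p) {a b c d a' b' c' d' : α}
    (h : [a, b, c, d].Nodup) (h' : [a', b', c', d'].Nodup) {e f : E}
    (he : (p e : Equiv.Perm α) = Equiv.swap a b * Equiv.swap c d)
    (hf : (p f : Equiv.Perm α) = Equiv.swap a' b' * Equiv.swap c' d') : e * e = f * f := by
  obtain ⟨z, -, hzz, hz, hker⟩ := hp.exists_central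
  refine AltCover.sq_eq_sq_of_lift p hp.1 (fun k hk => ?_) h h' he hf
  rcases (hker k).1 hk with rfl | rfl
  · simp
  · exact ⟨hzz, hz⟩

/-- If, in each of two double covers of `Aₙ`, some lift of a product of two disjoint transpositions
has non-trivial square, then they are isomorphic. -/
theorem coverIso_of_sq_ne_one {p : E →* alternatingGroup (Fin n)}
    {p' : E' →* alternatingGroup (Fin n)} (hp : IsDoubleCover p) (hp' : IsDoubleCover p')
    {a b c d : Fin n} (hn : [a, b, c, d].Nodup)
    (h : ∃ e, (p e : Equiv.Perm (Fin n)) = Equiv.swap a b * Equiv.swap c d ∧ e * e ≠ 1)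
    (h' : ∃ e, (p' e : Equiv.Perm (Fin n)) = Equiv.swap a b * Equiv.swap c d ∧ e * e ≠ 1) :
    CoverIso p p' := by
  obtain ⟨e, he, hee⟩ := h
  obtain ⟨e', he', hee'⟩ := h'
  refine coverIso_of_sq_eq_one_iff hp hp' fun a' b' i j hnd x y hx hy => ?_
  rw [hp.sq_eq_sq_of_lift hnd hn hx he, hp'.sq_eq_sq_of_lift hnd hn hy he']
  exact iff_of_false hee hee'

/-- A double cover of `Aₙ` is trivial if all lifts of products of two disjoint transpositions are
involutions. -/
theorem coverIso_fst_of_sq_eq_one {p : E →* alternatingGroup (Fin n)} (hp : IsDoubleCover p)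
    (h : ∀ a b c d : Fin n, [a, b, c, d].Nodup → ∀ e,
      (p e : Equiv.Perm (Fin n)) = Equiv.swap a b * Equiv.swap c d → e * e = 1) :
    CoverIso p (MonoidHom.fst (alternatingGroup (Fin n)) (Multiplicative (ZMod 2))) := by
  refine coverIso_of_sq_eq_one_iff hp (isDoubleCover_fst _) fun a b i j hnd x y hx hy =>
    iff_of_true (h _ _ _ _ hnd x hx) (fst_mul_self_eq_one (Subtype.ext ?_))
  rw [Subgroup.coe_mul]
  change (y.1 : Equiv.Perm (Fin n)) = _ at hy
  rw [hy]
  exact swap_mul_swap_mul_self hnd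

/-- In the product cover every lift of an involution squares to `1`, and isomorphisms of covers
preserve this. -/
theorem not_coverIso_fst {p : E →* alternatingGroup (Fin n)} {a b c d : Fin n}
    (hn : [a, b, c, d].Nodup)
    (h : ∃ e, (p e : Equiv.Perm (Fin n)) = Equiv.swap a b * Equiv.swap c d ∧ e * e ≠ 1) :
    ¬ CoverIso p (MonoidHom.fst (alternatingGroup (Fin n)) (Multiplicative (ZMod 2))) := by
  obtain ⟨e, he, hee⟩ := h
  refine fun hiso => hee (hiso.sq_eq_one_iff.2 (fun f hf => fst_mul_self_eq_one ?_) e rfl)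
  rw [show f.1 = p e from hf]
  exact Subtype.ext (by
    rw [Subgroup.coe_mul, he]
    exact swap_mul_swap_mul_self hn)

end Main

end AltCover

open AltCover in
theorem mainTheorem3 (n : ℕ) :
    (IsDoubleCover (projS n) ∧ IsDoubleCover (projA n)) ∧
    (IsNontrivialDoubleCover (projA n) ↔ 4 ≤ n) ∧
    (4 ≤ n →
      (∀ (E : Type u) [Group E] (p : E →* alternatingGroup (Fin n)),
        IsNontrivialDoubleCover p → CoverIso (projA n) p) ∧
      CoverIso (projA n) (spinCoverA n)) := by
  have hnodup : ∀ h : 4 ≤ n, [(⟨0, by omega⟩ : Fin n), ⟨1, by omega⟩, ⟨2, by omega⟩,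
      ⟨3, by omega⟩].Nodup := fun h => by simp
  refine ⟨⟨isDoubleCover_projS n, isDoubleCover_projA n⟩, ⟨fun ⟨_, hnt⟩ => ?_, fun h =>
    ⟨isDoubleCover_projA n, not_coverIso_fst (hnodup h) (exists_lift_projA_sq_ne_one h)⟩⟩,
    fun h => ⟨fun E _ p ⟨hp, hnt⟩ => ?_, ?_⟩⟩
  -- With fewer than four letters there is no double transposition, so the criterion for triviality
  -- holds vacuously.
  · by_contra hn
    refine hnt (coverIso_fst_of_sq_eq_one (isDoubleCover_projA n) fun a b c d hnd => ?_)
    have := hnd.length_le_card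
    rw [Fintype.card_fin] at this
    exact absurd this hn
  · refine coverIso_of_sq_ne_one (isDoubleCover_projA n) hp (hnodup h)
      (exists_lift_projA_sq_ne_one h) ?_
    -- If every lift of `(0 1)(2 3)` squared to `1`, the same would hold for all double
    -- transpositions and `p` would be trivial.
    by_contra hall
    push Not at hall
    refine hnt (coverIso_fst_of_sq_eq_one hp fun a b c d hnd e he => ?_)
    obtain ⟨f, hf⟩ := hp.1 ⟨_, swap_mul_swap_mem_alternatingGroup
      (show (⟨0, by omega⟩ : Fin n) ≠ ⟨1, by omega⟩ by simp)
      (show (⟨2, by omega⟩ : Fin n) ≠ ⟨3, by omega⟩ by simp)⟩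
    have hf' := congrArg Subtype.val hf
    rw [hp.sq_eq_sq_of_lift hnd (hnodup h) he hf']
    exact hall f hf'
  · refine coverIso_of_sq_ne_one (isDoubleCover_projA n) (isDoubleCover_spinCoverA h) (hnodup h)
      (exists_lift_projA_sq_ne_one h) ?_
    obtain ⟨e, he, he2⟩ := exists_lift_spinCoverA_sq h
    refine ⟨e, he, fun h1 => neg_one_ne_one_clifford (n := n) ?_⟩
    rw [← he2, h1]
    rfl
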